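/- **Setting.** Let $f:\{\pm1\}^n\to\{\pm1\}$ with $n\ge 1$; expectations and probabilities are over uniform $x\in\{\pm1\}^n$, and $\log=\log_2$. Put $\hat f(S)=\mathbb E[f(x)\prod_{i\in S}x_i]$. For $\delta\in(0,1)$ let $\mathrm{NS}_\delta(f)=\Pr[f(x)\ne f(\tilde x)]$, where $\tilde x$ is obtained from $x$ by rerandomizing each coordinate independently with probability $\delta$, and let $\mathrm{Inf}_i^{(\delta,d)}(f)=\sum_{S\ni i,\,|S|\le d}(1-\delta)^{|S|}\hat f(S)^2$. The size of a decision tree is its number of leaves, $\mathrm{error}_f(T)=\Pr[f(x)\ne T(x)]$, and $\mathrm{opt}_s$ is the least error of a size-$s$ decision tree. For a leaf $\ell$ at depth $|\ell|$, $f_\ell$ is the subfunction of $f$ obtained by restricting the attributes along the path to $\ell$. **Algorithm** $\textsc{BuildStabilizingDT}_f(t,\delta,\varepsilon)$. Let $d=\log(1/\varepsilon)/\delta$ and start from the one-leaf tree with unlabelled leaf. While the size is less than $t$: give each leaf $\ell$ the score $2^{-|\ell|}\max_i\mathrm{Inf}^{(\delta,d)}_i(f_\ell)$, choose a leaf $\ell^\star$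 of highest score, and split it with a query to an attribute $x_i$ maximizing $\mathrm{Inf}^{(\delta,d)}_i(f_{\ell^\star})$ (ties are broken arbitrarily). Finally label each leaf $\ell$ with $\mathrm{sign}(\mathbb E[f_\ell])$ and return the resulting tree. **Cost.** The algorithm accesses $f$ only through exact queries $(\ell,S)\mapsto\widehat{f_\ell}(S)$. A query costs $2^{c|\ell|}+|\ell|+|S|$ steps, where $c\in\mathbb N$ is a parameter of the cost model: for $c=0$ an exact expectation is an elementary operation, while for $c>0$ it is charged for the probability $2^{-|\ell|}$ that an example reaches $\ell$. Real arithmetic, comparisons and list operations have unit cost per element. The program computes each influence by enumerating all sets $S$ with $|S|\le d$. **Theorem.** There are absolute constants $A,C>0$ and, for every $c\in\mathbb N$, a constant $B_c$ depending only on $c$, such that the following holds. Let $n\ge1$, $f:\{\pm1\}^n\to\{\pm1\}$, $\delta,\kappa\in(0,1)$ with $\mathrm{NS}_\delta(f)\le\kappa$, $s\ge1$ an integer, $\varepsilon\in(0,\frac12)$, and let $t$ be any integer with $$t\ \ge\ s^{A\,\kappa\log(s/\varepsilon)/(\varepsilon\delta)},$$ so that one may take $t=s^{\tilde\Theta(\kappa\log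 s/(\varepsilon\delta))}$, where $\tilde\Theta$ hides a factor at most $1+\log(1/\varepsilon)$ (for $s\ge 2$) and rounding up. Then: 1. However ties are broken, $\textsc{BuildStabilizingDT}_f(t,\delta,\varepsilon)$ returns a tree $T$ of size $t$ with $\mathrm{error}_f(T)\le C(\mathrm{opt}_s+\kappa)+\varepsilon$. 2. With $c=0$, the program returns such an output within $B_0\,(t\cdot n^{\log(1/\varepsilon)/\delta})^{B_0}$ steps, i.e. in time $\mathrm{poly}(t,n^{\log(1/\varepsilon)/\delta})$. 3. For every $c\in\mathbb N$ there is $t'\in\{1,\dots,t\}$ such that the program $\textsc{BuildStabilizingDT}_f(t',\delta,\varepsilon)$, with queries charged $2^{c|\ell|}+|\ell|+|S|$, returns an output of that algorithm, of size $t'$ and error at most $C(\mathrm{opt}_s+\kappa)+\varepsilon$, within $B_c\,(t'\cdot n^{\log(1/\varepsilon)/\delta})^{B_c}$ steps. -/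

import Mathlib

open scoped BigOperators

noncomputable section

namespace StabDT

/-! ### Boolean functions, Fourier coefficients, noise -/

/-- The discrete cube `{±1}^n`; the two-element type `ℤˣ = {1, -1}` plays the role of `{±1}`. -/
abbrev Cube (n : ℕ) : Type := Fin n → ℤˣ

/-- A sign as a real number. -/
def sgnVal (b : ℤˣ) : ℝ := ((b : ℤ) : ℝ)

/-- The sign of a real number, with `sign 0 = 1`. -/
def signOf (a : ℝ) : ℤˣ := if 0 ≤ a then 1 else -1

/-- Expectation of `f` under the uniform distribution. -/
def avg {n : ℕ} (f : Cube n → ℤˣ) : ℝ := 𝔼 x, sgnVal (f x)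

/-- The Fourier coefficient `E[f(x) ∏_{i ∈ S} x_i]`. -/
def fhat {n : ℕ} (f : Cube n → ℤˣ) (S : Finset (Fin n)) : ℝ :=
  𝔼 x, sgnVal (f x) * ∏ i ∈ S, sgnVal (x i)

/-- `Pr[f(x) ≠ g(x)]` for uniform `x`. -/
def disagree {n : ℕ} (f g : Cube n → ℤˣ) : ℝ :=
  𝔼 x, if f x ≠ g x then (1 : ℝ) else 0

/-- Noise sensitivity `Pr[f(x) ≠ f(x')]`: `x` is uniform, the set `R` of rerandomized coordinates
contains each coordinate independently with probability `δ`, and `x'` equals a fresh uniform `y`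
on `R` and `x` off `R`. -/
def noiseSens {n : ℕ} (δ : ℝ) (f : Cube n → ℤˣ) : ℝ :=
  𝔼 x : Cube n, ∑ R : Finset (Fin n), δ ^ R.card * (1 - δ) ^ (n - R.card) *
    𝔼 y : Cube n, if f x ≠ f (R.piecewise y x) then (1 : ℝ) else 0

/-- The `δ`-noisy `d`-wise influence of coordinate `i` on `f`. -/
def noisyInf {n : ℕ} (δ d : ℝ) (f : Cube n → ℤˣ) (i : Fin n) : ℝ :=
  ∑ S : Finset (Fin n) with i ∈ S ∧ (S.card : ℝ) ≤ d, (1 - δ) ^ S.card * fhat f S ^ 2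

/-! ### Decision trees -/

/-- Binary trees with internal nodes labelled by coordinates and leaves labelled by `α`.
In `node i a b` the subtree `a` handles `x_i = -1` and `b` handles `x_i = 1`. -/
inductive DecTree (n : ℕ) (α : Type) : Type
  | leaf (a : α) : DecTree n α
  | node (i : Fin n) (neg pos : DecTree n α) : DecTree n α

/-- Decision trees. -/
abbrev DTree (n : ℕ) : Type := DecTree n ℤˣ

/-- Partial decision trees (unlabelled leaves). -/
abbrev PTree (n : ℕ) : Type := DecTree n Unit

/-- A leaf, given by the queries and answers on the way from the root to it. -/
abbrev Branch (n : ℕ) : Type := List (Fin n × ℤˣ)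

/-- The number of leaves. -/
def DecTree.size {n : ℕ} {α : Type} : DecTree n α → ℕ
  | .leaf _ => 1
  | .node _ a b => a.size + b.size

/-- The function computed by a decision tree. -/
def DecTree.eval {n : ℕ} : DTree n → Cube n → ℤˣ
  | .leaf v, _ => v
  | .node i a b, x => if x i = -1 then a.eval x else b.eval x

/-- The leaves of a tree. -/
def DecTree.leaves {n : ℕ} {α : Type} : DecTree n α → List (Branch n)
  | .leaf _ => [[]]
  | .node i a b => a.leaves.map ((i, -1) :: ·) ++ b.leaves.map ((i, 1) :: ·)

/-- The subfunction `f_{x_i = b}`, regarded as a function on the whole cube. -/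
def fixCoord {n : ℕ} (f : Cube n → ℤˣ) (i : Fin n) (b : ℤˣ) : Cube n → ℤˣ :=
  fun x => f (Function.update x i b)

/-- The subfunction `f_ℓ` at a leaf `ℓ`. -/
def subfn {n : ℕ} : (Cube n → ℤˣ) → Branch n → (Cube n → ℤˣ)
  | f, [] => f
  | f, (i, b) :: p => subfn (fixCoord f i b) p

/-- Split the leaf `p` of a partial tree with a query to `x_i`. -/
def DecTree.split {n : ℕ} : PTree n → Branch n → Fin n → PTree n
  | .leaf _, _, i => .node i (.leaf ()) (.leaf ())
  | .node j a b, [], _ => .node j a b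
  | .node j a b, (_, v) :: p, i =>
      if v = -1 then .node j (a.split p i) b else .node j a (b.split p i)

/-- The `f`-completion: each leaf `ℓ` is labelled with `sign (E[f_ℓ])`. -/
def completion {n : ℕ} : (Cube n → ℤˣ) → PTree n → DTree n
  | f, .leaf _ => .leaf (signOf (avg f))
  | f, .node i a b => .node i (completion (fixCoord f i (-1)) a) (completion (fixCoord f i 1) b)

/-- Classification error of a decision tree. -/
def err {n : ℕ} (f : Cube n → ℤˣ) (T : DTree n) : ℝ := disagree f T.eval

/-- The least error of a size-`s` decision tree. -/
def opt {n : ℕ} (f : Cube n → ℤˣ) (s : ℕ) : ℝ :=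
  sInf {e : ℝ | ∃ T : DTree n, T.size = s ∧ e = err f T}

/-! ### The algorithm, with arbitrary tie-breaking -/

/-- The score `2^{-|ℓ|} · max_i Inf_i^{(δ,d)}(f_ℓ)` of a leaf. -/
def leafScore {n : ℕ} (δ d : ℝ) (f : Cube n → ℤˣ) (p : Branch n) : ℝ :=
  (1 / 2) ^ p.length * ⨆ i, noisyInf δ d (subfn f p) i

/-- One iteration: a leaf of highest score is split with a query to an attribute of highest
`δ`-noisy `d`-wise influence on the subfunction at that leaf. -/
def Step {n : ℕ} (δ d : ℝ) (f : Cube n → ℤˣ) (T T' : PTree n) : Prop :=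
  ∃ p ∈ T.leaves, ∃ i : Fin n,
    (∀ q ∈ T.leaves, leafScore δ d f q ≤ leafScore δ d f p) ∧
    (∀ j, noisyInf δ d (subfn f p) j ≤ noisyInf δ d (subfn f p) i) ∧
    T' = T.split p i

/-- The truncation degree `d = log₂(1/ε)/δ`. -/
def degBound (δ ε : ℝ) : ℝ := Real.logb 2 (1 / ε) / δ

/-- `T` is a possible output of `BuildStabilizingDT_f(t, δ, ε)`, for some way of breaking ties:
iterations are performed from the empty tree until the size is `t`, and the `f`-completion is
returned. -/
def IsOutput {n : ℕ} (f : Cube n → ℤˣ) (t : ℕ) (δ ε : ℝ) (T : DTree n) : Prop :=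
  ∃ P : PTree n, Relation.ReflTransGen (Step δ (degBound δ ε) f) (.leaf ()) P ∧
    P.size = t ∧ T = completion f P

/-! ### Step-counted programs -/

/-- A result together with the number of elementary steps spent on it. -/
structure Timed (α : Type) : Type where
  val : α
  cost : ℕ

instance : Monad Timed where
  pure a := ⟨a, 0⟩
  bind m g := ⟨(g m.val).val, m.cost + (g m.val).cost⟩

/-- Spend `k` steps. -/
def tick (k : ℕ) : Timed Unit := ⟨(), k⟩

/-- The only access of a program to the target function: given a leaf `ℓ` and a list of
coordinates `S`, the answer is meant to be `E[f_ℓ(x) ∏_{i ∈ S} x_i]`. -/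
abbrev Oracle (n : ℕ) : Type := Branch n → List (Fin n) → ℝ

/-- The oracle belonging to `f`. -/
def oracleOf {n : ℕ} (f : Cube n → ℤˣ) : Oracle n :=
  fun p S => fhat (subfn f p) S.toFinset

/-- A query about a leaf `ℓ` costs `2^{c|ℓ|}` steps, plus the length of the question. With `c = 0`
exact expectations are elementary; with `c > 0` they are charged for the
small probability `2^{-|ℓ|}` that an example reaches `ℓ`. -/
def query {n : ℕ} (c : ℕ) (O : Oracle n) (p : Branch n) (S : List (Fin n)) : Timed ℝ :=
  ⟨O p S, 2 ^ (c * p.length) + p.length + S.length⟩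

/-- Powers by repeated multiplication. -/
def powT (a : ℝ) : ℕ → Timed ℝ
  | 0 => do
    tick 1
    return 1
  | k + 1 => do
    let b ← powT a k
    tick 1
    return a * b

/-- All sublists of a list that have at most `r` members. -/
def subsetsT {n : ℕ} : List (Fin n) → ℝ → Timed (List (List (Fin n)))
  | [], _ => do
    tick 1
    return [[]]
  | a :: L, r => do
    tick 1
    if 1 ≤ r then
      let A ← subsetsT L (r - 1)
      let B ← subsetsT L r
      tick (A.length + B.length)
      return A.map (a :: ·) ++ B
    else
      return [[]]

/-- The sum of `(1-δ)^{|S|} E[f_ℓ(x) ∏_{j ∈ S} x_j]^2` over the listed sets `S` containing `i`. -/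
def influenceT {n : ℕ} (c : ℕ) (O : Oracle n) (δ : ℝ) (p : Branch n) (i : Fin n) :
    List (List (Fin n)) → Timed ℝ
  | [] => do
    tick 1
    return 0
  | S :: L => do
    let r ← influenceT c O δ p i L
    tick (S.length + 1)
    if i ∈ S then
      let a ← query c O p S
      let w ← powT (1 - δ) S.length
      tick 3
      return w * a ^ 2 + r
    else
      return r

/-- Linear search for a candidate of largest value; `cur` is the best pair so far. -/
def argmaxT {α β : Type} (g : α → Timed (β × ℝ)) (cur : β × ℝ) : List α → Timed (β × ℝ)
  | [] => do
    tick 1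
    return cur
  | a :: L => do
    let new ← g a
    tick 1
    if cur.2 < new.2 then argmaxT g new L else argmaxT g cur L

/-- The attribute of largest influence at a leaf, with the score of the leaf.
The search starts from the value `-1`, below every influence. -/
def scoreT {n : ℕ} [NeZero n] (c : ℕ) (O : Oracle n) (δ : ℝ) (Ss : List (List (Fin n)))
    (p : Branch n) : Timed ((Branch n × Fin n) × ℝ) := do
  tick n
  let best ← argmaxT
    (fun i : Fin n => do
      let v ← influenceT c O δ p i Ss
      return (i, v))
    (0, -1) (List.finRange n)
  let w ← powT (1 / 2) p.length
  tick 1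
  return ((p, best.1), w * best.2)

/-- List the leaves of a partial tree. -/
def leavesT {n : ℕ} : PTree n → Timed (List (Branch n))
  | .leaf _ => do
    tick 1
    return [[]]
  | .node i a b => do
    let A ← leavesT a
    let B ← leavesT b
    tick (A.length + B.length + 1)
    return A.map ((i, -1) :: ·) ++ B.map ((i, 1) :: ·)

/-- Split a leaf, walking down the tree to it. -/
def splitT {n : ℕ} : PTree n → Branch n → Fin n → Timed (PTree n)
  | .leaf _, _, i => do
    tick 1
    return .node i (.leaf ()) (.leaf ())
  | .node j a b, [], _ => do
    tick 1
    return .node j a b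
  | .node j a b, (_, v) :: p, i => do
    tick 1
    if v = -1 then
      let a' ← splitT a p i
      return .node j a' b
    else
      let b' ← splitT b p i
      return .node j a b'

/-- `k` iterations of the main loop. -/
def growT {n : ℕ} [NeZero n] (c : ℕ) (O : Oracle n) (δ : ℝ) (Ss : List (List (Fin n))) :
    ℕ → PTree n → Timed (PTree n)
  | 0, T => do
    tick 1
    return T
  | k + 1, T => do
    let ls ← leavesT T
    let best ← argmaxT (scoreT c O δ Ss) (([], 0), -1) ls
    let T' ← splitT T best.1.1 best.1.2
    tick 1
    growT c O δ Ss k T'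

/-- Label the leaves; `p` is the path from the root to the current subtree. -/
def completeT {n : ℕ} (c : ℕ) (O : Oracle n) : Branch n → PTree n → Timed (DTree n)
  | p, .leaf _ => do
    let a ← query c O p []
    tick 1
    return .leaf (signOf a)
  | p, .node i a b => do
    tick (2 * p.length + 1)
    let A ← completeT c O (p ++ [(i, -1)]) a
    let B ← completeT c O (p ++ [(i, 1)]) b
    return .node i A B

/-- The program `BuildStabilizingDT(t, δ, ε)`. Every iteration of the loop adds one leaf, so
`t - 1` iterations lead from the empty tree to size `t`. -/
def buildT {n : ℕ} [NeZero n] (c : ℕ) (O : Oracle n) (t : ℕ) (δ ε : ℝ) : Timed (DTree n) := do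
  tick (n + 3)
  let Ss ← subsetsT (List.finRange n) (degBound δ ε)
  let P ← growT c O δ Ss (t - 1) (.leaf ())
  completeT c O [] P

end StabDT

end

open StabDT

noncomputable section

namespace StabDT

/-! ### Fourier analysis on the cube -/

/-! The potential is the expected noise stability `stab` of the subfunction at the leaf reached by a
random walk. By `noiseSens_eq` it is at least 1 - 2κ at the start, and it never exceeds 1. Splitting
a leaf raises it by at least δ times the score of that leaf (`stab_split`). If the largest noisy
influence, averaged over the random leaf, is at least γ, then the best of the m leaves has score at
least γ/m; the gains δγ/m add up to at least δγ ln m. As long as such a γ is available, δγ ln m ≤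
2κ, and this fails at the prescribed size (`err_le_of_reach`).

It remains to find γ for every inaccurate tree. The tool is an inequality of OSSS type
(`Computed.cov_le`): a real function g whose influences are all small has small covariance with any
tree of small depth and size. At a leaf ℓ, g is a smoothed and truncated version of f_ℓ: its
influences are exactly the noisy influences (`infl_smooth`), and it is L²-close to f_ℓ when f_ℓ is
noise stable. The tree is a near-optimal tree for f, cut at depth O(log(s/ε)) and restricted to ℓ.
Up to disagreement and noise sensitivity, the covariance is then at least a constant times the
variance of f_ℓ, so a leaf far from constant has an influential coordinate (`constErr_sub_le`).
Disagreement and noise sensitivity do not increase on average over the leaves, which yields γ =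
`scoreBound`, of order ε/(log s · log(s/ε)) (`ReadOnce.scoreBound_le`).

A score of at least γ/m has two further effects. The queried coordinate is new on its branch, so
2^{-|ℓ|} really is the probability of the leaf; and the split leaf satisfies 2^{|ℓ|} ≤ m/γ, which
keeps charged queries polynomial (`Good.two_pow_length_le`). Both may fail once the goal is reached,
but splitting never increases the error, so accuracy persists. For charged queries the program is
therefore stopped at the first size that meets the goal. -/

lemma sgnVal_one : sgnVal 1 = 1 := by simp [sgnVal]

lemma sgnVal_neg_one : sgnVal (-1) = -1 := by simp [sgnVal]

lemma sgnVal_sq (b : ℤˣ) : sgnVal b * sgnVal b = 1 := by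
  rcases Int.units_eq_one_or b with rfl | rfl <;> simp [sgnVal]

/-- Flipping x_i preserves the uniform measure, and the two updates of x at i are x and its flip in
some order. -/
lemma expect_split {n : ℕ} (F : Cube n → ℝ) (i : Fin n) :
    𝔼 x, F x = ((𝔼 x, F (Function.update x i (-1))) + 𝔼 x, F (Function.update x i 1)) / 2 := by
  have hinv : Function.Involutive fun x : Cube n => Function.update x i (-(x i)) := by
    intro x
    simp
  have h : 𝔼 x : Cube n, F (Function.update x i (-(x i))) = 𝔼 x, F x :=
    Fintype.expect_equiv hinv.toPerm _ _ fun x => rfl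
  have h2 : ∀ x : Cube n, F (Function.update x i (-1)) + F (Function.update x i 1) =
      F x + F (Function.update x i (-(x i))) := by
    intro x
    rcases Int.units_eq_one_or (x i) with hx | hx
    · rw [hx]
      have : Function.update x i 1 = x := by rw [← hx]; simp
      rw [this]; ring
    · rw [hx]
      have : Function.update x i (-1) = x := by rw [← hx]; simp
      rw [this]; simp
  rw [← Finset.expect_add_distrib, Finset.expect_congr rfl fun x _ => h2 x,
    Finset.expect_add_distrib, h]
  ring

/-- The parity function of a set of coordinates. -/
def parity {n : ℕ} (S : Finset (Fin n)) (x : Cube n) : ℝ := ∏ i ∈ S, sgnVal (x i)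

/-- The Fourier coefficients of a real function. -/
def coeff {n : ℕ} (F : Cube n → ℝ) (S : Finset (Fin n)) : ℝ := 𝔼 x, F x * parity S x

lemma parity_update_of_notMem {n : ℕ} {S : Finset (Fin n)} {i : Fin n} (h : i ∉ S) (x : Cube n)
    (b : ℤˣ) : parity S (Function.update x i b) = parity S x := by
  refine Finset.prod_congr rfl fun j hj => ?_
  rw [Function.update_of_ne]
  rintro rfl
  exact h hj

lemma parity_update_of_mem {n : ℕ} {S : Finset (Fin n)} {i : Fin n} (h : i ∈ S) (x : Cube n)
    (b : ℤˣ) : parity S (Function.update x i b) = sgnVal b * parity (S.erase i) x := by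
  rw [parity, ← Finset.mul_prod_erase _ _ h, Function.update_self]
  congr 1
  exact parity_update_of_notMem (Finset.notMem_erase i S) x b

lemma expect_parity_mul_of_notMem {n : ℕ} {S T : Finset (Fin n)} {i : Fin n} (h : i ∈ S)
    (h' : i ∉ T) : 𝔼 x : Cube n, parity S x * parity T x = 0 := by
  rw [expect_split _ i]
  simp only [parity_update_of_mem h, parity_update_of_notMem h', sgnVal_one, sgnVal_neg_one]
  rw [← Finset.expect_add_distrib]
  simp

lemma parity_mul_self {n : ℕ} (S : Finset (Fin n)) (x : Cube n) :
    parity S x * parity S x = 1 := by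
  rw [parity, ← Finset.prod_mul_distrib]
  simp [sgnVal_sq]

lemma expect_const' {n : ℕ} (a : ℝ) : 𝔼 _x : Cube n, a = a :=
  Finset.expect_const Finset.univ_nonempty a

lemma expect_parity_mul {n : ℕ} (S T : Finset (Fin n)) :
    𝔼 x : Cube n, parity S x * parity T x = if S = T then 1 else 0 := by
  split_ifs with h
  · subst h
    simp only [parity_mul_self]
    exact expect_const' 1
  · by_cases h1 : S ⊆ T
    · obtain ⟨i, hi, hi'⟩ := Finset.not_subset.1 fun h2 => h (h1.antisymm h2)
      simp only [mul_comm (parity S _)]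
      exact expect_parity_mul_of_notMem hi hi'
    · obtain ⟨i, hi, hi'⟩ := Finset.not_subset.1 h1
      exact expect_parity_mul_of_notMem hi hi'

/-- The function with the given Fourier coefficients. -/
def ofCoeff {n : ℕ} (a : Finset (Fin n) → ℝ) (x : Cube n) : ℝ := ∑ S, a S * parity S x

lemma expect_ofCoeff_mul {n : ℕ} (a b : Finset (Fin n) → ℝ) :
    𝔼 x : Cube n, ofCoeff a x * ofCoeff b x = ∑ S, a S * b S := by
  have h : ∀ x : Cube n, ofCoeff a x * ofCoeff b x =
      ∑ S, ∑ T, a S * b T * (parity S x * parity T x) := by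
    intro x
    simp only [ofCoeff, Finset.sum_mul_sum]
    exact Finset.sum_congr rfl fun S _ => Finset.sum_congr rfl fun T _ => by ring
  simp only [h, Finset.expect_sum_comm, ← Finset.mul_expect, expect_parity_mul]
  simp

/-- The sum is the expansion of ∏ (1 + x_i y_i), which has a zero factor wherever x and y differ.
This gives Fourier inversion. -/
lemma sum_parity_mul {n : ℕ} (x y : Cube n) :
    ∑ S, parity S x * parity S y = if y = x then (2 : ℝ) ^ n else 0 := by
  have h : ∑ S, parity S x * parity S y = ∏ i, (1 + sgnVal (x i) * sgnVal (y i)) := by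
    rw [Finset.prod_one_add, Finset.powerset_univ]
    simp only [parity, Finset.prod_mul_distrib]
  rw [h]
  split_ifs with hxy
  · subst hxy
    simp only [sgnVal_sq]
    norm_num
  · obtain ⟨i, hi⟩ := Function.ne_iff.1 hxy
    refine Finset.prod_eq_zero (Finset.mem_univ i) ?_
    rcases Int.units_eq_one_or (x i) with h1 | h1 <;> rcases Int.units_eq_one_or (y i) with h2 | h2
      <;> simp_all [sgnVal]

lemma ofCoeff_coeff {n : ℕ} (F : Cube n → ℝ) : ofCoeff (coeff F) = F := by
  ext x
  have h : ofCoeff (coeff F) x = 𝔼 y : Cube n, F y * if y = x then (2 : ℝ) ^ n else 0 := by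
    simp only [ofCoeff, coeff, Finset.expect_mul, ← Finset.expect_sum_comm, ← sum_parity_mul,
      Finset.mul_sum]
    refine Finset.expect_congr rfl fun y _ => Finset.sum_congr rfl fun S _ => by ring
  rw [h, Fintype.expect_eq_sum_div_card]
  simp

lemma expect_mul_eq_sum_coeff {n : ℕ} (F G : Cube n → ℝ) :
    𝔼 x, F x * G x = ∑ S, coeff F S * coeff G S := by
  conv_lhs => rw [← ofCoeff_coeff F, ← ofCoeff_coeff G]
  exact expect_ofCoeff_mul _ _

lemma expect_sq_ofCoeff {n : ℕ} (a : Finset (Fin n) → ℝ) :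
    𝔼 x : Cube n, ofCoeff a x ^ 2 = ∑ S, a S ^ 2 := by
  simp only [pow_two]
  exact expect_ofCoeff_mul a a

/-- A Boolean function as a real function. -/
def toReal {n : ℕ} (f : Cube n → ℤˣ) (x : Cube n) : ℝ := sgnVal (f x)

lemma sum_fhat_sq {n : ℕ} (f : Cube n → ℤˣ) : ∑ S, fhat f S ^ 2 = 1 := by
  have h := expect_mul_eq_sum_coeff (toReal f) (toReal f)
  simp only [toReal, sgnVal_sq, expect_const'] at h
  rw [h]
  exact Finset.sum_congr rfl fun S _ => pow_two _

/-! ### Noise sensitivity in terms of Fourier coefficients. -/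

lemma ite_ne_eq (a b : ℤˣ) : (if a ≠ b then (1 : ℝ) else 0) = (1 - sgnVal a * sgnVal b) / 2 := by
  rcases Int.units_eq_one_or a with rfl | rfl <;> rcases Int.units_eq_one_or b with rfl | rfl <;>
    norm_num [sgnVal]

/-- Noise stability. -/
def stab {n : ℕ} (δ : ℝ) (f : Cube n → ℤˣ) : ℝ := ∑ S, (1 - δ) ^ S.card * fhat f S ^ 2

lemma expect_parity_piecewise {n : ℕ} (R S : Finset (Fin n)) (x : Cube n) :
    𝔼 y : Cube n, parity S (R.piecewise y x) = if Disjoint R S then parity S x else 0 := by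
  split_ifs with h
  · have : ∀ y : Cube n, parity S (R.piecewise y x) = parity S x := by
      intro y
      refine Finset.prod_congr rfl fun j hj => ?_
      rw [Finset.piecewise_eq_of_notMem _ _ _ (Finset.disjoint_right.1 h hj)]
    simp only [this, expect_const']
  · obtain ⟨i, hi, hi'⟩ := Finset.not_disjoint_iff.1 h
    rw [expect_split _ i]
    have : ∀ (y : Cube n) (b : ℤˣ), R.piecewise (Function.update y i b) x =
        Function.update (R.piecewise y x) i b := by
      intro y b
      rw [Finset.update_piecewise_of_mem _ _ _ hi]
    simp only [this, parity_update_of_mem hi', sgnVal_one, sgnVal_neg_one]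
    rw [← Finset.expect_add_distrib]
    simp

/-- This is the probability that the rerandomized set misses S. It comes from expanding a product in
which the weight δ is replaced by 0 for the coordinates of S. -/
lemma sum_binomial_disjoint {n : ℕ} (δ : ℝ) (S : Finset (Fin n)) :
    ∑ R : Finset (Fin n), (if Disjoint R S then δ ^ R.card * (1 - δ) ^ (n - R.card) else 0) =
      (1 - δ) ^ S.card := by
  have h := Finset.prod_add (fun i : Fin n => if i ∈ S then (0 : ℝ) else δ) (fun _ => 1 - δ)
    Finset.univ
  have h1 : ∏ i : Fin n, ((if i ∈ S then (0 : ℝ) else δ) + (1 - δ)) = (1 - δ) ^ S.card := by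
    have : ∀ i : Fin n, (if i ∈ S then (0 : ℝ) else δ) + (1 - δ) = if i ∈ S then 1 - δ else 1 := by
      intro i; split_ifs <;> ring
    simp only [this, Finset.prod_ite_mem, Finset.univ_inter, Finset.prod_const]
  rw [← h1, h, Finset.powerset_univ]
  refine Finset.sum_congr rfl fun R _ => ?_
  rw [Finset.prod_const, Finset.card_sdiff_of_subset (Finset.subset_univ R), Finset.card_univ,
    Fintype.card_fin]
  split_ifs with hd
  · congr 1
    rw [Finset.prod_congr rfl (g := fun _ => δ), Finset.prod_const]
    intro i hi
    rw [if_neg (Finset.disjoint_left.1 hd hi)]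
  · obtain ⟨i, hi, hi'⟩ := Finset.not_disjoint_iff.1 hd
    rw [Finset.prod_eq_zero hi (by simp [hi']), zero_mul]

lemma sum_binomial {n : ℕ} (δ : ℝ) :
    ∑ R : Finset (Fin n), δ ^ R.card * (1 - δ) ^ (n - R.card) = 1 := by
  simpa using sum_binomial_disjoint (n := n) δ ∅

lemma expect_expect_piecewise {n : ℕ} (f : Cube n → ℤˣ) (R : Finset (Fin n)) :
    𝔼 x : Cube n, sgnVal (f x) * 𝔼 y : Cube n, sgnVal (f (R.piecewise y x)) =
      ∑ S, if Disjoint R S then fhat f S ^ 2 else 0 := by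
  have h : ∀ x : Cube n, 𝔼 y : Cube n, sgnVal (f (R.piecewise y x)) =
      ofCoeff (fun S => if Disjoint R S then fhat f S else 0) x := by
    intro x
    have : ∀ y : Cube n, sgnVal (f (R.piecewise y x)) =
        ∑ S, fhat f S * parity S (R.piecewise y x) := fun y =>
      (congrFun (ofCoeff_coeff (toReal f)) (R.piecewise y x)).symm
    simp only [this, Finset.expect_sum_comm, ← Finset.mul_expect, expect_parity_piecewise, ofCoeff]
    refine Finset.sum_congr rfl fun S _ => by split_ifs <;> simp
  simp only [h]
  have h2 : ∀ x, sgnVal (f x) = ofCoeff (fhat f) x := fun x =>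
    (congrFun (ofCoeff_coeff (toReal f)) x).symm
  simp only [h2]
  rw [expect_ofCoeff_mul]
  refine Finset.sum_congr rfl fun S _ => by split_ifs <;> simp [pow_two]

lemma noiseSens_eq {n : ℕ} (δ : ℝ) (f : Cube n → ℤˣ) : noiseSens δ f = (1 - stab δ f) / 2 := by
  have h1 : noiseSens δ f = ∑ R : Finset (Fin n), δ ^ R.card * (1 - δ) ^ (n - R.card) *
      ((1 - ∑ S, if Disjoint R S then fhat f S ^ 2 else 0) / 2) := by
    rw [noiseSens, Finset.expect_sum_comm]
    refine Finset.sum_congr rfl fun R _ => ?_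
    rw [← Finset.mul_expect]
    congr 1
    rw [← expect_expect_piecewise]
    simp only [ite_ne_eq, ← Finset.expect_div, Finset.expect_sub_distrib, expect_const',
      Finset.mul_expect]
  have h2 : stab δ f = ∑ R : Finset (Fin n), δ ^ R.card * (1 - δ) ^ (n - R.card) *
      ∑ S, if Disjoint R S then fhat f S ^ 2 else 0 := by
    simp only [stab, ← sum_binomial_disjoint, Finset.sum_mul, Finset.mul_sum]
    rw [Finset.sum_comm]
    refine Finset.sum_congr rfl fun R _ => Finset.sum_congr rfl fun S _ => by split_ifs <;> simp
  rw [h1, h2]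
  have h3 := sum_binomial (n := n) δ
  rw [show ∀ a : ℝ, (1 - a) / 2 = ((∑ R : Finset (Fin n), δ ^ R.card * (1 - δ) ^ (n - R.card)) - a) / 2
    from fun a => by rw [h3], ← Finset.sum_sub_distrib, Finset.sum_div]
  exact Finset.sum_congr rfl fun R _ => by ring

lemma stab_le_one {n : ℕ} {δ : ℝ} (h0 : 0 < δ) (h1 : δ < 1) (f : Cube n → ℤˣ) :
    stab δ f ≤ 1 := by
  rw [← sum_fhat_sq f]
  refine Finset.sum_le_sum fun S _ => ?_
  exact mul_le_of_le_one_left (sq_nonneg _) (pow_le_one₀ (by linarith) (by linarith))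

lemma noisyInf_nonneg {n : ℕ} {δ : ℝ} (h1 : δ < 1) (d : ℝ) (f : Cube n → ℤˣ) (i : Fin n) :
    0 ≤ noisyInf δ d f i :=
  Finset.sum_nonneg fun _ _ => mul_nonneg (pow_nonneg (by linarith) _) (sq_nonneg _)

lemma noisyInf_le_one {n : ℕ} {δ : ℝ} (h0 : 0 < δ) (h1 : δ < 1) (d : ℝ) (f : Cube n → ℤˣ)
    (i : Fin n) : noisyInf δ d f i ≤ 1 := by
  refine le_trans ?_ (stab_le_one h0 h1 f)
  exact Finset.sum_le_sum_of_subset_of_nonneg (Finset.filter_subset _ _)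
    fun _ _ _ => mul_nonneg (pow_nonneg (by linarith) _) (sq_nonneg _)

/-! ### Fixing a coordinate -/

lemma fhat_fixCoord_of_mem {n : ℕ} (f : Cube n → ℤˣ) {i : Fin n} (b : ℤˣ) {S : Finset (Fin n)}
    (h : i ∈ S) : fhat (fixCoord f i b) S = 0 := by
  change 𝔼 x, sgnVal (f (Function.update x i b)) * parity S x = 0
  rw [expect_split _ i]
  simp only [parity_update_of_mem h, sgnVal_one, sgnVal_neg_one, Function.update_idem]
  rw [← Finset.expect_add_distrib]
  simp

lemma fhat_eq_of_notMem {n : ℕ} (f : Cube n → ℤˣ) {i : Fin n} {S : Finset (Fin n)}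
    (h : i ∉ S) : fhat f S = (fhat (fixCoord f i (-1)) S + fhat (fixCoord f i 1) S) / 2 := by
  change 𝔼 x, sgnVal (f x) * parity S x = _
  rw [expect_split _ i]
  simp only [parity_update_of_notMem h]
  rfl

lemma fhat_insert_eq {n : ℕ} (f : Cube n → ℤˣ) {i : Fin n} {S : Finset (Fin n)}
    (h : i ∉ S) : fhat f (insert i S) =
      (fhat (fixCoord f i 1) S - fhat (fixCoord f i (-1)) S) / 2 := by
  change 𝔼 x, sgnVal (f x) * parity (insert i S) x = _
  rw [expect_split _ i]
  simp only [parity_update_of_mem (Finset.mem_insert_self i S), Finset.erase_insert h, sgnVal_one,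
    sgnVal_neg_one, neg_one_mul, mul_neg, one_mul, Finset.expect_neg_distrib]
  change (-(fhat (fixCoord f i (-1)) S) + fhat (fixCoord f i 1) S) / 2 = _
  ring

lemma sum_finset_split {n : ℕ} (i : Fin n) (F : Finset (Fin n) → ℝ) :
    ∑ S, F S = ∑ S ∈ (Finset.univ.erase i).powerset, (F S + F (insert i S)) := by
  rw [Finset.sum_add_distrib, ← Finset.sum_powerset_insert (Finset.notMem_erase i _),
    Finset.insert_erase (Finset.mem_univ i), Finset.powerset_univ]

/-- For S not containing i, let u, v be the coefficients at S of the two restrictions. The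
coefficients of f at S and S ∪ {i} are (u ± v)/2, and (u² + v²)/2 is the sum of their squares.
Restricting thus moves the weight of S ∪ {i} down to S, where it is damped by one factor 1 - δ less;
the gain is at least δ times the damped weight. -/
lemma stab_split {n : ℕ} {δ : ℝ} (h0 : 0 < δ) (h1 : δ < 1) (d : ℝ) (f : Cube n → ℤˣ) (i : Fin n) :
    stab δ f + δ * noisyInf δ d f i ≤
      (stab δ (fixCoord f i (-1)) + stab δ (fixCoord f i 1)) / 2 := by
  have hinf : noisyInf δ d f i ≤ ∑ S, if i ∈ S then (1 - δ) ^ S.card * fhat f S ^ 2 else 0 := by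
    rw [noisyInf, Finset.sum_filter]
    refine Finset.sum_le_sum fun S _ => ?_
    have : 0 ≤ (1 - δ) ^ S.card * fhat f S ^ 2 :=
      mul_nonneg (pow_nonneg (by linarith) _) (sq_nonneg _)
    by_cases h : i ∈ S
    · simp only [h, true_and, if_true]
      split_ifs <;> linarith
    · simp [h]
  have key : stab δ f + δ * (∑ S, if i ∈ S then (1 - δ) ^ S.card * fhat f S ^ 2 else 0) ≤
      (stab δ (fixCoord f i (-1)) + stab δ (fixCoord f i 1)) / 2 := by
    simp only [stab]
    rw [sum_finset_split i, sum_finset_split i (fun S => if i ∈ S then _ else _),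
      sum_finset_split i, sum_finset_split i (fun S => (1 - δ) ^ S.card *
        fhat (fixCoord f i 1) S ^ 2), Finset.mul_sum, ← Finset.sum_add_distrib,
      ← Finset.sum_add_distrib, Finset.sum_div]
    refine Finset.sum_le_sum fun S hS => ?_
    have hi : i ∉ S := fun h => Finset.notMem_erase i _ (Finset.mem_powerset.1 hS h)
    have hi' : i ∈ insert i S := Finset.mem_insert_self i S
    rw [if_neg hi, if_pos hi', fhat_fixCoord_of_mem f _ hi', fhat_fixCoord_of_mem f _ hi',
      fhat_eq_of_notMem f hi, fhat_insert_eq f hi, Finset.card_insert_of_notMem hi,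
      pow_succ (1 - δ)]
    generalize fhat (fixCoord f i 1) S = u
    generalize fhat (fixCoord f i (-1)) S = v
    have hp : 0 ≤ (1 - δ) ^ S.card := pow_nonneg (by linarith) _
    generalize (1 - δ) ^ S.card = a at *
    nlinarith [mul_nonneg hp (mul_nonneg (sq_nonneg δ) (sq_nonneg (u - v)))]
  nlinarith

/-! ### A covariance inequality for shallow decision trees -/

/-- `k` is computed by a decision tree of depth at most `D` and size at most `s`. -/
inductive Computed {n : ℕ} : (Cube n → ℤˣ) → ℕ → ℕ → Prop
  | const (c : ℤˣ) (D : ℕ) {s : ℕ} (hs : 1 ≤ s) : Computed (fun _ => c) D s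
  | node {k : Cube n → ℤˣ} (i : Fin n) {D s s₁ s₂ : ℕ} (h₁ : Computed (fixCoord k i (-1)) D s₁)
      (h₂ : Computed (fixCoord k i 1) D s₂) (hs : s₁ + s₂ ≤ s) : Computed k (D + 1) s

lemma Computed.one_le {n : ℕ} {k : Cube n → ℤˣ} {D s : ℕ} (h : Computed k D s) : 1 ≤ s := by
  induction h with
  | const c D hs => exact hs
  | node i h₁ h₂ hs ih₁ ih₂ => omega

lemma Computed.mono {n : ℕ} {k : Cube n → ℤˣ} {D s : ℕ} (h : Computed k D s) :
    ∀ {D' s' : ℕ}, D ≤ D' → s ≤ s' → Computed k D' s' := by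
  induction h with
  | const c D hs => exact fun _ h => .const c _ (hs.trans h)
  | node i h₁ h₂ hs ih₁ ih₂ =>
    intro D' s' hD hs'
    obtain ⟨D', rfl⟩ : ∃ E, D' = E + 1 := ⟨D' - 1, by omega⟩
    exact .node i (ih₁ (by omega) le_rfl) (ih₂ (by omega) le_rfl) (hs.trans hs')

lemma fixCoord_fixCoord_self {n : ℕ} (k : Cube n → ℤˣ) (i : Fin n) (b c : ℤˣ) :
    fixCoord (fixCoord k i b) i c = fixCoord k i b := by
  ext x
  simp [fixCoord]

lemma fixCoord_comm {n : ℕ} (k : Cube n → ℤˣ) {i j : Fin n} (h : i ≠ j) (b c : ℤˣ) :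
    fixCoord (fixCoord k i b) j c = fixCoord (fixCoord k j c) i b := by
  ext x
  simp only [fixCoord]
  rw [Function.update_comm h]

/-- If the root queries the fixed coordinate, one of its subtrees alone computes the restriction;
otherwise both subtrees are restricted. -/
lemma Computed.fixCoord {n : ℕ} {k : Cube n → ℤˣ} {D s : ℕ} (h : Computed k D s) (j : Fin n)
    (c : ℤˣ) : Computed (fixCoord k j c) D s := by
  induction h with
  | const a D hs => exact .const a D hs
  | @node k i D s s₁ s₂ h₁ h₂ hs ih₁ ih₂ =>
    by_cases hij : i = j
    · subst hij
      rcases Int.units_eq_one_or c with rfl | rfl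
      · exact h₂.mono (by omega) (by omega)
      · exact h₁.mono (by omega) (by omega)
    · rw [fixCoord_comm k hij] at ih₁ ih₂
      exact .node i ih₁ ih₂ hs

lemma exists_computed_eval {n : ℕ} (T : DTree n) : ∃ D, Computed T.eval D T.size := by
  induction T with
  | leaf v => exact ⟨0, .const v 0 le_rfl⟩
  | node i a b iha ihb =>
    obtain ⟨D₁, h₁⟩ := iha
    obtain ⟨D₂, h₂⟩ := ihb
    refine ⟨max D₁ D₂ + 1, .node i (s₁ := a.size) (s₂ := b.size) ?_ ?_ le_rfl⟩
    · have h : StabDT.fixCoord (DecTree.eval (.node i a b)) i (-1) =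
          StabDT.fixCoord a.eval i (-1) := by
        ext x; simp [StabDT.fixCoord, DecTree.eval]
      rw [h]
      exact (h₁.fixCoord i _).mono (le_max_left _ _) le_rfl
    · have h : StabDT.fixCoord (DecTree.eval (.node i a b)) i 1 =
          StabDT.fixCoord b.eval i 1 := by
        ext x; simp [StabDT.fixCoord, DecTree.eval]
      rw [h]
      exact (h₂.fixCoord i _).mono (le_max_right _ _) le_rfl

lemma computed_of_dependsOn {n : ℕ} (U : Finset (Fin n)) : ∀ f : Cube n → ℤˣ,
    (∀ x y : Cube n, (∀ i ∈ U, x i = y i) → f x = f y) → Computed f U.card (2 ^ U.card) := by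
  induction U using Finset.induction_on with
  | empty =>
    intro f hf
    have : f = fun _ => f 1 := funext fun x => hf x 1 (by simp)
    rw [this]
    exact .const _ _ (by simp)
  | insert i U hi ih =>
    intro f hf
    rw [Finset.card_insert_of_notMem hi]
    have h : ∀ b, Computed (fixCoord f i b) U.card (2 ^ U.card) := by
      intro b
      refine ih _ fun x y hxy => hf _ _ fun j hj => ?_
      by_cases hji : j = i
      · subst hji; simp
      · simp only [ne_eq, hji, not_false_eq_true, Function.update_of_ne]
        exact hxy j ((Finset.mem_insert.1 hj).resolve_left hji)
    exact .node i (h _) (h _) (by rw [pow_succ]; omega)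

lemma computed_self {n : ℕ} (f : Cube n → ℤˣ) : Computed f n (2 ^ n) := by
  have := computed_of_dependsOn Finset.univ f fun x y h => congrArg f (funext fun i => h i (by simp))
  simpa using this

/-! ### Disagreement, and cutting a tree at bounded depth. -/

lemma disagree_nonneg {n : ℕ} (f g : Cube n → ℤˣ) : 0 ≤ disagree f g :=
  Finset.expect_nonneg fun _ _ => by split_ifs <;> norm_num

lemma disagree_le_one {n : ℕ} (f g : Cube n → ℤˣ) : disagree f g ≤ 1 := by
  rw [← expect_const' (n := n) 1]
  exact Finset.expect_le_expect fun _ _ => by split_ifs <;> norm_num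

lemma disagree_triangle {n : ℕ} (f g h : Cube n → ℤˣ) :
    disagree f h ≤ disagree f g + disagree g h := by
  rw [disagree, disagree, disagree, ← Finset.expect_add_distrib]
  refine Finset.expect_le_expect fun x _ => ?_
  by_cases h1 : f x = g x
  · simp [h1]
  · by_cases h2 : g x = h x
    · simp [h2]
    · simp only [ne_eq, h1, h2, not_false_eq_true, if_true]
      split_ifs <;> norm_num

lemma disagree_split {n : ℕ} (f g : Cube n → ℤˣ) (i : Fin n) :
    disagree f g = (disagree (fixCoord f i (-1)) (fixCoord g i (-1)) +
      disagree (fixCoord f i 1) (fixCoord g i 1)) / 2 :=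
  expect_split _ i

lemma exists_fixCoord_disagree_le {n : ℕ} (k v : Cube n → ℤˣ) (i : Fin n) (b : ℤˣ) :
    ∃ c, disagree (fixCoord k i b) (fixCoord v i c) ≤ disagree (fixCoord k i b) v := by
  by_contra! h
  have h0 := disagree_split (fixCoord k i b) v i
  simp only [fixCoord_fixCoord_self] at h0
  linarith [h (-1), h 1]

/-- Cutting at depth E spoils at most s branches, each followed with probability 2^{-E}. -/
lemma Computed.truncate {n : ℕ} {k : Cube n → ℤˣ} {D s : ℕ} (h : Computed k D s) :
    ∀ E : ℕ, ∃ k', Computed k' E s ∧ disagree k k' ≤ s / 2 ^ E := by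
  induction h with
  | const c D hs =>
    intro E
    refine ⟨_, .const c E hs, ?_⟩
    have : disagree (n := n) (fun _ => c) (fun _ => c) = 0 := by simp [disagree]
    rw [this]
    positivity
  | @node k i D s s₁ s₂ h₁ h₂ hs ih₁ ih₂ =>
    have hs1 := h₁.one_le
    intro E
    rcases E with _ | E
    · refine ⟨_, .const 1 0 (by omega), (disagree_le_one _ _).trans ?_⟩
      have : 1 ≤ s := by omega
      simpa using this
    · obtain ⟨k₁, hk₁, hd₁⟩ := ih₁ E
      obtain ⟨k₂, hk₂, hd₂⟩ := ih₂ E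
      -- The approximation k₁ may depend on x_i. Fixing x_i in it to the better of the two values
      -- costs nothing, because the function it approximates ignores x_i; then the two halves can be
      -- glued under a query to x_i.
      obtain ⟨c₁, hc₁⟩ := exists_fixCoord_disagree_le k k₁ i (-1)
      obtain ⟨c₂, hc₂⟩ := exists_fixCoord_disagree_le k k₂ i 1
      have e₁ : StabDT.fixCoord (fun x => if x i = -1 then StabDT.fixCoord k₁ i c₁ x else
          StabDT.fixCoord k₂ i c₂ x) i (-1) = StabDT.fixCoord k₁ i c₁ := by
        ext x; simp [StabDT.fixCoord]
      have e₂ : StabDT.fixCoord (fun x => if x i = -1 then StabDT.fixCoord k₁ i c₁ x else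
          StabDT.fixCoord k₂ i c₂ x) i 1 = StabDT.fixCoord k₂ i c₂ := by
        ext x; simp [StabDT.fixCoord]
      refine ⟨fun x => if x i = -1 then StabDT.fixCoord k₁ i c₁ x else
        StabDT.fixCoord k₂ i c₂ x, .node i (D := E) (s₁ := s₁) (s₂ := s₂) ?_ ?_ hs, ?_⟩
      · rw [e₁]; exact hk₁.fixCoord i c₁
      · rw [e₂]; exact hk₂.fixCoord i c₂
      · rw [disagree_split _ _ i, e₁, e₂]
        have hs' : (s₁ : ℝ) + s₂ ≤ s := by exact_mod_cast hs
        have : (s : ℝ) / 2 ^ (E + 1) = s / 2 ^ E / 2 := by rw [pow_succ]; field_simp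
        rw [this]
        have h3 : (s₁ : ℝ) / 2 ^ E + s₂ / 2 ^ E ≤ s / 2 ^ E := by rw [← add_div]; gcongr
        linarith

/-! ### Averaging over a coordinate, influences and covariance. -/

/-- The average of `g` over coordinate `i`. -/
def coordAvg {n : ℕ} (g : Cube n → ℝ) (i : Fin n) (x : Cube n) : ℝ :=
  (g (Function.update x i (-1)) + g (Function.update x i 1)) / 2

/-- The Laplacian of `g` in direction `i`. -/
def lap {n : ℕ} (g : Cube n → ℝ) (i : Fin n) (x : Cube n) : ℝ := g x - coordAvg g i x

/-- The influence of coordinate `i` on the real function `g`. -/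
def infl {n : ℕ} (g : Cube n → ℝ) (i : Fin n) : ℝ := 𝔼 x, lap g i x ^ 2

lemma coordAvg_update {n : ℕ} (g : Cube n → ℝ) (i : Fin n) (x : Cube n) (b : ℤˣ) :
    coordAvg g i (Function.update x i b) = coordAvg g i x := by
  simp [coordAvg]

lemma expect_coordAvg {n : ℕ} (g : Cube n → ℝ) (i : Fin n) : 𝔼 x, coordAvg g i x = 𝔼 x, g x := by
  rw [expect_split g i, ← Finset.expect_add_distrib, Finset.expect_div]
  rfl

lemma lap_coordAvg {n : ℕ} (g : Cube n → ℝ) (i j : Fin n) (x : Cube n) :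
    lap (coordAvg g i) j x = coordAvg (lap g j) i x := by
  by_cases h : i = j
  · subst h
    simp [lap, coordAvg]
    ring
  · have hc : ∀ b c : ℤˣ, Function.update (Function.update x i b) j c =
        Function.update (Function.update x j c) i b := fun b c => Function.update_comm h _ _ _
    simp only [lap, coordAvg, hc]
    ring

/-- Averaging over x_i commutes with the Laplacian, and squaring is convex. -/
lemma infl_coordAvg_le {n : ℕ} (g : Cube n → ℝ) (i j : Fin n) :
    infl (coordAvg g i) j ≤ infl g j := by
  simp only [infl, lap_coordAvg]
  rw [expect_split (fun x => lap g j x ^ 2) i, ← Finset.expect_add_distrib, Finset.expect_div]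
  refine Finset.expect_le_expect fun x _ => ?_
  simp only [coordAvg]
  nlinarith [sq_nonneg (lap g j (Function.update x i (-1)) - lap g j (Function.update x i 1))]

/-- The covariance of two functions under the uniform distribution. -/
def cov {n : ℕ} (g h : Cube n → ℝ) : ℝ := (𝔼 x, g x * h x) - (𝔼 x, g x) * 𝔼 x, h x

/-- Write g as its Laplacian plus its average over x_i. The Laplacian has mean zero, so any constant
μ may be subtracted from k against it. The average ignores x_i, so it passes to both restrictions of
k unchanged. -/
lemma cov_split {n : ℕ} (g : Cube n → ℝ) (k : Cube n → ℤˣ) (i : Fin n) (μ : ℝ) :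
    cov g (toReal k) = (𝔼 x, lap g i x * (toReal k x - μ)) +
      (cov (coordAvg g i) (toReal (fixCoord k i (-1))) +
        cov (coordAvg g i) (toReal (fixCoord k i 1))) / 2 := by
  have h1 : 𝔼 x, lap g i x * (toReal k x - μ) =
      (𝔼 x, g x * toReal k x) - 𝔼 x, coordAvg g i x * toReal k x := by
    have : ∀ x, lap g i x * (toReal k x - μ) =
        g x * toReal k x - coordAvg g i x * toReal k x - (g x - coordAvg g i x) * μ := by
      intro x; simp only [lap]; ring
    simp only [this, Finset.expect_sub_distrib, ← Finset.expect_mul, expect_coordAvg]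
    ring
  have h2 : 𝔼 x, coordAvg g i x * toReal k x =
      ((𝔼 x, coordAvg g i x * toReal (fixCoord k i (-1)) x) +
        𝔼 x, coordAvg g i x * toReal (fixCoord k i 1) x) / 2 := by
    rw [expect_split _ i]
    simp only [coordAvg_update]
    rfl
  have h3 : 𝔼 x, toReal k x =
      ((𝔼 x, toReal (fixCoord k i (-1)) x) + 𝔼 x, toReal (fixCoord k i 1) x) / 2 :=
    expect_split _ i
  simp only [cov, expect_coordAvg]
  rw [h1, h2, h3]
  ring

/-- Equivalent to 4ab ≤ (a + b)² when s = a + b. Summed along a tree, it bounds the average depth by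
log s. -/
lemma one_add_logb_le {a b s : ℕ} (ha : 1 ≤ a) (hb : 1 ≤ b) (h : a + b ≤ s) :
    1 + (Real.logb 2 a + Real.logb 2 b) / 2 ≤ Real.logb 2 s := by
  have ha' : (0 : ℝ) < a := by exact_mod_cast ha
  have hb' : (0 : ℝ) < b := by exact_mod_cast hb
  have h' : (a : ℝ) + b ≤ s := by exact_mod_cast h
  have h1 : Real.logb 2 (4 * (a * b)) ≤ Real.logb 2 ((s : ℝ) ^ 2) := by
    apply Real.logb_le_logb_of_le (by norm_num) (by positivity)
    nlinarith [sq_nonneg ((a : ℝ) - b)]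
  rw [Real.logb_mul (by norm_num) (by positivity), Real.logb_mul ha'.ne' hb'.ne',
    Real.logb_pow, show (4 : ℝ) = 2 ^ 2 by norm_num, Real.logb_pow, Real.logb_self_eq_one
    (by norm_num)] at h1
  push_cast at h1
  linarith

/-- Induction along the tree by `cov_split`. Each node contributes the product of a Laplacian with k
- μ, split by AM-GM with parameter α. The Laplacian parts cost α M / 2 per query, and the average
number of queries is at most log s. The parts with (k - μ)² average exactly over the two subtrees,
so each of the D levels costs the same. -/
lemma Computed.cov_le {n : ℕ} {k : Cube n → ℤˣ} {D s : ℕ} (h : Computed k D s) {α M : ℝ}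
    (hα : 0 < α) (hM : 0 ≤ M) (μ : ℝ) : ∀ g : Cube n → ℝ, (∀ i, infl g i ≤ M) →
    cov g (toReal k) ≤ α / 2 * M * Real.logb 2 s + D / (2 * α) * 𝔼 x, (toReal k x - μ) ^ 2 := by
  induction h with
  | @const c D s hs =>
    intro g _
    have h0 : cov g (toReal fun _ => c) = 0 := by
      simp only [cov, toReal, ← Finset.expect_mul, expect_const', sub_self]
    rw [h0]
    have h1 : 0 ≤ Real.logb 2 s := Real.logb_nonneg (by norm_num) (by exact_mod_cast hs)
    have h2 : 0 ≤ 𝔼 x : Cube n, (toReal (fun _ => c) x - μ) ^ 2 :=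
      Finset.expect_nonneg fun _ _ => sq_nonneg _
    positivity
  | @node k i D s s₁ s₂ h₁ h₂ hs ih₁ ih₂ =>
    intro g hg
    rw [cov_split g k i μ]
    have hg' : ∀ j, infl (coordAvg g i) j ≤ M := fun j => (infl_coordAvg_le g i j).trans (hg j)
    have b₁ := ih₁ _ hg'
    have b₂ := ih₂ _ hg'
    have b₃ : 𝔼 x, lap g i x * (toReal k x - μ) ≤
        α / 2 * M + 1 / (2 * α) * 𝔼 x, (toReal k x - μ) ^ 2 := by
      calc 𝔼 x, lap g i x * (toReal k x - μ)
          ≤ 𝔼 x, (α / 2 * lap g i x ^ 2 + 1 / (2 * α) * (toReal k x - μ) ^ 2) := by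
            refine Finset.expect_le_expect fun x _ => ?_
            have h : α / 2 * lap g i x ^ 2 + 1 / (2 * α) * (toReal k x - μ) ^ 2 -
                lap g i x * (toReal k x - μ) =
                1 / (2 * α) * (α * lap g i x - (toReal k x - μ)) ^ 2 := by
              field_simp; ring
            have : 0 ≤ 1 / (2 * α) * (α * lap g i x - (toReal k x - μ)) ^ 2 := by positivity
            linarith
        _ = α / 2 * infl g i + 1 / (2 * α) * 𝔼 x, (toReal k x - μ) ^ 2 := by
            rw [Finset.expect_add_distrib, ← Finset.mul_expect, ← Finset.mul_expect]
            rfl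
        _ ≤ _ := by gcongr; exact hg i
    have h3 : 𝔼 x, (toReal k x - μ) ^ 2 = ((𝔼 x, (toReal (StabDT.fixCoord k i (-1)) x - μ) ^ 2) +
        𝔼 x, (toReal (StabDT.fixCoord k i 1) x - μ) ^ 2) / 2 := expect_split _ i
    have h4 := mul_le_mul_of_nonneg_left (one_add_logb_le h₁.one_le h₂.one_le hs)
      (mul_nonneg (half_pos hα).le hM)
    have h5 : ((D + 1 : ℕ) : ℝ) / (2 * α) * 𝔼 x, (toReal k x - μ) ^ 2 =
        1 / (2 * α) * (𝔼 x, (toReal k x - μ) ^ 2) + (D / (2 * α) *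
          (𝔼 x, (toReal (StabDT.fixCoord k i (-1)) x - μ) ^ 2) + D / (2 * α) *
          𝔼 x, (toReal (StabDT.fixCoord k i 1) x - μ) ^ 2) / 2 := by
      rw [h3]; push_cast; field_simp; ring
    rw [h5]
    linarith

/-! ### Influence of an unbalanced noise-stable function close to a tree -/

lemma lap_ofCoeff {n : ℕ} (a : Finset (Fin n) → ℝ) (i : Fin n) (x : Cube n) :
    lap (ofCoeff a) i x = ofCoeff (fun S => if i ∈ S then a S else 0) x := by
  simp only [lap, coordAvg, ofCoeff]
  rw [← Finset.sum_add_distrib, Finset.sum_div, ← Finset.sum_sub_distrib]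
  refine Finset.sum_congr rfl fun S _ => ?_
  split_ifs with h
  · simp only [parity_update_of_mem h, sgnVal_one, sgnVal_neg_one]
    ring
  · simp only [parity_update_of_notMem h]
    ring

/-- The Fourier coefficients of the smoothed and truncated version of `f`. -/
def smoothCoeff {n : ℕ} (δ d : ℝ) (f : Cube n → ℤˣ) (S : Finset (Fin n)) : ℝ :=
  if (S.card : ℝ) ≤ d then √((1 - δ) ^ S.card) * fhat f S else 0

/-- The square root in `smoothCoeff` is chosen for this: squaring a coefficient leaves one factor (1
- δ)^{|S|}. -/
lemma infl_smooth {n : ℕ} {δ : ℝ} (h1 : δ < 1) (d : ℝ) (f : Cube n → ℤˣ) (i : Fin n) :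
    infl (ofCoeff (smoothCoeff δ d f)) i = noisyInf δ d f i := by
  simp only [infl, lap_ofCoeff]
  rw [expect_sq_ofCoeff, noisyInf, Finset.sum_filter]
  refine Finset.sum_congr rfl fun S _ => ?_
  have : 0 ≤ (1 - δ) ^ S.card := pow_nonneg (by linarith) _
  by_cases hi : i ∈ S <;> by_cases hd : (S.card : ℝ) ≤ d <;>
    simp [smoothCoeff, hi, hd, mul_pow, Real.sq_sqrt this]

/-- Since ε < 1/2, exceeding the degree bound forces δm > 1, so (1 - δ)^m ≤ e^{-1}. Only this
constant is needed, not the stronger bound by ε. -/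
lemma pow_le_half_of_degBound_lt {δ ε : ℝ} (h0 : 0 < δ) (h1 : δ < 1) (hε : 0 < ε) (hε' : ε < 1 / 2)
    {m : ℕ} (h : degBound δ ε < m) : (1 - δ) ^ m ≤ 1 / 2 := by
  have h2 : 1 < Real.logb 2 (1 / ε) := by
    rw [Real.lt_logb_iff_rpow_lt (by norm_num) (by positivity), Real.rpow_one]
    rw [lt_div_iff₀ hε]; linarith
  have h3 : 1 < δ * m := by
    rw [degBound, div_lt_iff₀ h0] at h
    linarith
  calc (1 - δ) ^ m ≤ (Real.exp (-δ)) ^ m :=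
        pow_le_pow_left₀ (by linarith) (by linarith [Real.add_one_le_exp (-δ)]) _
    _ = Real.exp (-(δ * m)) := by rw [← Real.exp_nat_mul]; congr 1; ring
    _ ≤ Real.exp (-1) := Real.exp_le_exp.2 (by linarith)
    _ ≤ 1 / 2 := by
      rw [Real.exp_neg, ← one_div]
      exact one_div_le_one_div_of_le (by norm_num) (by linarith [Real.add_one_le_exp (1 : ℝ)])

/-- Compare coefficients, with p = (1 - δ)^{|S|} and 4 `noiseSens` = 2(1 - `stab`). A kept
coefficient costs (1 - √p)² ≤ 2(1 - p); a discarded one has p ≤ 1/2 and costs 1 ≤ 2(1 - p). -/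
lemma expect_smooth_sub_sq_le {n : ℕ} {δ ε : ℝ} (h0 : 0 < δ) (h1 : δ < 1) (hε : 0 < ε)
    (hε' : ε < 1 / 2) (f : Cube n → ℤˣ) :
    𝔼 x, (ofCoeff (smoothCoeff δ (degBound δ ε) f) x - toReal f x) ^ 2 ≤
      4 * noiseSens δ f := by
  have h : ∀ x, ofCoeff (smoothCoeff δ (degBound δ ε) f) x - toReal f x =
      ofCoeff (fun S => smoothCoeff δ (degBound δ ε) f S - fhat f S) x := by
    intro x
    rw [← ofCoeff_coeff (toReal f)]
    simp only [ofCoeff, sub_mul, Finset.sum_sub_distrib]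
    rfl
  simp only [h]
  rw [expect_sq_ofCoeff, noiseSens_eq, stab, show ∀ a b : ℝ, 4 * ((a - b) / 2) = 2 * (a - b) from fun a b => by ring]
  have h3 : ∀ a : ℝ, 2 * (1 - a) = 2 * (∑ S, fhat f S ^ 2 - a) := fun a => by rw [sum_fhat_sq]
  rw [h3, ← Finset.sum_sub_distrib, Finset.mul_sum]
  refine Finset.sum_le_sum fun S _ => ?_
  have hp : 0 ≤ (1 - δ) ^ S.card := pow_nonneg (by linarith) _
  have hp1 : (1 - δ) ^ S.card ≤ 1 := pow_le_one₀ (by linarith) (by linarith)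
  have hf := sq_nonneg (fhat f S)
  unfold smoothCoeff
  split_ifs with hd
  · have e := Real.sq_sqrt hp
    have h2 := Real.sqrt_nonneg ((1 - δ) ^ S.card)
    have h3 : √((1 - δ) ^ S.card) ≤ 1 := Real.sqrt_le_one.2 hp1
    rw [show (√((1 - δ) ^ S.card) * fhat f S - fhat f S) ^ 2 =
      (1 - √((1 - δ) ^ S.card)) ^ 2 * fhat f S ^ 2 by ring]
    have : (1 - √((1 - δ) ^ S.card)) ^ 2 ≤ 2 * (1 - (1 - δ) ^ S.card) := by nlinarith
    nlinarith
  · have := pow_le_half_of_degBound_lt h0 h1 hε hε' (not_le.1 hd)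
    nlinarith

/-- The error of the best constant approximation. -/
def constErr {n : ℕ} (f : Cube n → ℤˣ) : ℝ := (1 - |avg f|) / 2

lemma sq_expect_le {n : ℕ} (a : Cube n → ℝ) : (𝔼 x, a x) ^ 2 ≤ 𝔼 x, a x ^ 2 := by
  have h : 0 ≤ 𝔼 x, (a x - 𝔼 y, a y) ^ 2 := Finset.expect_nonneg fun _ _ => sq_nonneg _
  have e : ∀ x, (a x - 𝔼 y, a y) ^ 2 = a x ^ 2 - (2 * 𝔼 y, a y) * a x + (𝔼 y, a y) ^ 2 :=
    fun x => by ring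
  simp only [e, Finset.expect_add_distrib, Finset.expect_sub_distrib, ← Finset.mul_expect,
    expect_const'] at h
  linarith

lemma expect_toReal_sub_sq {n : ℕ} (k f : Cube n → ℤˣ) :
    𝔼 x, (toReal k x - toReal f x) ^ 2 = 4 * disagree f k := by
  rw [disagree, Finset.mul_expect]
  refine Finset.expect_congr rfl fun x _ => ?_
  rw [ite_ne_eq]
  have h1 := sgnVal_sq (f x)
  have h2 := sgnVal_sq (k x)
  simp only [toReal]
  nlinarith

/-- Both g and k are treated as perturbations of f. Expanding (g - m)(k - m) around (f - m)² loses a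
quarter of the variance and 5/2 of the squared distances; recentring from m to the true means loses
another 1/2. -/
lemma cov_ge {n : ℕ} (f k : Cube n → ℤˣ) (g : Cube n → ℝ) :
    3 / 4 * (1 - avg f ^ 2) - 3 * ((𝔼 x, (g x - toReal f x) ^ 2) +
      𝔼 x, (toReal k x - toReal f x) ^ 2) ≤ cov g (toReal k) := by
  set m := avg f with hm
  have hmE : 𝔼 x, toReal f x = m := rfl
  have hF : 𝔼 x, toReal f x ^ 2 = 1 := by
    simp only [toReal, pow_two, sgnVal_sq, expect_const']
  have hA := sq_expect_le fun x => g x - toReal f x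
  have hB := sq_expect_le fun x => toReal k x - toReal f x
  have hp : 𝔼 x, (3 / 4 * (toReal f x - m) ^ 2 - 5 / 2 * ((g x - toReal f x) ^ 2 +
      (toReal k x - toReal f x) ^ 2)) ≤ 𝔼 x, (g x - m) * (toReal k x - m) := by
    refine Finset.expect_le_expect fun x _ => ?_
    nlinarith [sq_nonneg (toReal f x - m + 4 * (g x - toReal f x)),
      sq_nonneg (toReal f x - m + 4 * (toReal k x - toReal f x)),
      sq_nonneg ((g x - toReal f x) + (toReal k x - toReal f x))]
  have hl : 𝔼 x, (3 / 4 * (toReal f x - m) ^ 2 - 5 / 2 * ((g x - toReal f x) ^ 2 +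
      (toReal k x - toReal f x) ^ 2)) = 3 / 4 * (1 - m ^ 2) - 5 / 2 *
      ((𝔼 x, (g x - toReal f x) ^ 2) + 𝔼 x, (toReal k x - toReal f x) ^ 2) := by
    have e : ∀ x, (toReal f x - m) ^ 2 = toReal f x ^ 2 - (2 * m) * toReal f x + m ^ 2 :=
      fun x => by ring
    rw [Finset.expect_sub_distrib, ← Finset.mul_expect, ← Finset.mul_expect,
      Finset.expect_add_distrib]
    simp only [e, Finset.expect_add_distrib, Finset.expect_sub_distrib, ← Finset.mul_expect,
      expect_const', hF, hmE]
    ring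
  have hr : 𝔼 x, (g x - m) * (toReal k x - m) =
      cov g (toReal k) + ((𝔼 x, g x) - m) * ((𝔼 x, toReal k x) - m) := by
    have e : ∀ x, (g x - m) * (toReal k x - m) =
        g x * toReal k x - m * g x - m * toReal k x + m ^ 2 := fun x => by ring
    simp only [e, Finset.expect_add_distrib, Finset.expect_sub_distrib, ← Finset.mul_expect,
      expect_const', cov]
    ring
  simp only [Finset.expect_sub_distrib, hmE] at hA hB
  rw [hl, hr] at hp
  nlinarith [sq_nonneg (((𝔼 x, g x) - m) - ((𝔼 x, toReal k x) - m))]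

lemma abs_avg_le_one {n : ℕ} (f : Cube n → ℤˣ) : |avg f| ≤ 1 := by
  have h := sq_expect_le (toReal f)
  simp only [toReal, pow_two (sgnVal _), sgnVal_sq, expect_const'] at h
  exact abs_le_one_iff_mul_self_le_one.2 (by rw [← pow_two]; exact h)

lemma constErr_sub_le {n : ℕ} {δ ε : ℝ} (h0 : 0 < δ) (h1 : δ < 1) (hε : 0 < ε)
    (hε' : ε < 1 / 2) (f k : Cube n → ℤˣ) {D s : ℕ} (hD : 1 ≤ D) (hk : Computed k D s) {M : ℝ}
    (hM0 : 0 ≤ M) (hM : ∀ i, noisyInf δ (degBound δ ε) f i ≤ M) :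
    5 / 4 * constErr f - 13 * (disagree f k + noiseSens δ f) ≤ 4 * D * Real.logb 2 s * M := by
  have hD' : (0 : ℝ) < D := by exact_mod_cast hD
  -- This α makes the coefficient D/(2α) equal to 1/16. The term in (k - m)² is at most twice the
  -- variance of f plus twice the squared distance, so it absorbs only 1/8 of the 3/4 of the
  -- variance from `cov_ge`. The remaining 5/8 gives 5/4 of `constErr`.
  have hu := hk.cov_le (α := 8 * D) (by positivity) hM0 (avg f)
    (ofCoeff (smoothCoeff δ (degBound δ ε) f)) fun i => (infl_smooth h1 _ f i).trans_le (hM i)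
  have hl := cov_ge f k (ofCoeff (smoothCoeff δ (degBound δ ε) f))
  have hA := expect_smooth_sub_sq_le h0 h1 hε hε' f
  have hB := expect_toReal_sub_sq k f
  have hH : 𝔼 x, (toReal k x - avg f) ^ 2 ≤
      2 * (1 - avg f ^ 2) + 2 * 𝔼 x, (toReal k x - toReal f x) ^ 2 := by
    have e : 2 * (1 - avg f ^ 2) = 𝔼 x, 2 * (toReal f x - avg f) ^ 2 := by
      have hmE : 𝔼 x, toReal f x = avg f := rfl
      have hF : 𝔼 x, toReal f x ^ 2 = 1 := by
        simp only [toReal, pow_two, sgnVal_sq, expect_const']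
      have e : ∀ x, (toReal f x - avg f) ^ 2 =
          toReal f x ^ 2 - (2 * avg f) * toReal f x + avg f ^ 2 := fun x => by ring
      simp only [e, ← Finset.mul_expect, Finset.expect_add_distrib, Finset.expect_sub_distrib,
        expect_const', hF, hmE]
      ring
    rw [e, Finset.mul_expect, ← Finset.expect_add_distrib]
    refine Finset.expect_le_expect fun x _ => ?_
    nlinarith [sq_nonneg ((toReal f x - avg f) - (toReal k x - toReal f x))]
  have hD2 : (D : ℝ) / (2 * (8 * D)) = 1 / 16 := by field_simp; norm_num
  rw [hD2] at hu
  have hv : 2 * constErr f ≤ 1 - avg f ^ 2 := by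
    have := abs_avg_le_one f
    rw [constErr, ← sq_abs]
    nlinarith [abs_nonneg (avg f)]
  have hd := disagree_nonneg f k
  have hA0 : 0 ≤ 𝔼 x, (ofCoeff (smoothCoeff δ (degBound δ ε) f) x - toReal f x) ^ 2 :=
    Finset.expect_nonneg fun _ _ => sq_nonneg _
  rw [hB] at hl hH
  have e : 8 * (D : ℝ) / 2 * M * Real.logb 2 s = 4 * D * Real.logb 2 s * M := by ring
  linarith

/-! ### Branches -/

/-- Overwrite the coordinates of `x` as prescribed by a branch; the first prescription wins. -/
def assign {n : ℕ} (q : Branch n) (x : Cube n) : Cube n :=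
  q.foldr (fun c y => Function.update y c.1 c.2) x

lemma subfn_eq {n : ℕ} (f : Cube n → ℤˣ) (q : Branch n) : subfn f q = fun x => f (assign q x) := by
  induction q generalizing f with
  | nil => rfl
  | cons c q ih => exact ih (fixCoord f c.1 c.2)

lemma subfn_append {n : ℕ} (f : Cube n → ℤˣ) (p q : Branch n) :
    subfn f (p ++ q) = subfn (subfn f p) q := by
  simp only [subfn_eq, assign, List.foldr_append]

lemma subfn_concat {n : ℕ} (f : Cube n → ℤˣ) (p : Branch n) (i : Fin n) (b : ℤˣ) :
    subfn f (p ++ [(i, b)]) = fixCoord (subfn f p) i b := by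
  rw [subfn_append]
  rfl

lemma assign_of_notMem {n : ℕ} {q : Branch n} {i : Fin n} (h : i ∉ q.map Prod.fst) (x : Cube n) :
    assign q x i = x i := by
  induction q with
  | nil => rfl
  | cons c q ih =>
    simp only [List.map_cons, List.mem_cons, not_or] at h
    change Function.update (assign q x) c.1 c.2 i = x i
    rw [Function.update_of_ne h.1, ih h.2]

lemma assign_update_of_mem {n : ℕ} {q : Branch n} {i : Fin n} (h : i ∈ q.map Prod.fst) (x : Cube n)
    (b : ℤˣ) : assign q (Function.update x i b) = assign q x := by
  induction q with
  | nil => simp at h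
  | cons c q ih =>
    change Function.update (assign q _) c.1 c.2 = Function.update (assign q x) c.1 c.2
    by_cases hq : i ∈ q.map Prod.fst
    · rw [ih hq]
    · have hc : i = c.1 := by
        simp only [List.map_cons, List.mem_cons] at h
        exact h.resolve_right hq
      ext j : 1
      by_cases hj : j = c.1
      · subst hj; simp
      · rw [Function.update_of_ne hj, Function.update_of_ne hj]
        by_cases hjq : j ∈ q.map Prod.fst
        · clear ih hq h
          induction q with
          | nil => simp at hjq
          | cons e q ih =>
            change Function.update (assign q _) e.1 e.2 j = Function.update (assign q x) e.1 e.2 j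
            by_cases hje : j = e.1
            · subst hje; simp
            · rw [Function.update_of_ne hje, Function.update_of_ne hje]
              simp only [List.map_cons, List.mem_cons, hje, false_or] at hjq
              exact ih hjq
        · rw [assign_of_notMem hjq, assign_of_notMem hjq, Function.update_of_ne (hc ▸ hj)]

lemma exists_assign_eq {n : ℕ} {q : Branch n} {i : Fin n} (h : i ∈ q.map Prod.fst) :
    ∃ c, ∀ x : Cube n, assign q x i = c := by
  induction q with
  | nil => simp at h
  | cons e q ih =>
    by_cases hi : i = e.1
    · refine ⟨e.2, fun x => ?_⟩
      change Function.update (assign q x) e.1 e.2 i = _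
      subst hi; simp
    · simp only [List.map_cons, List.mem_cons, hi, false_or] at h
      obtain ⟨c, hc⟩ := ih h
      refine ⟨c, fun x => ?_⟩
      change Function.update (assign q x) e.1 e.2 i = _
      rw [Function.update_of_ne hi, hc]

/-- The indicator of the inputs that follow a branch. -/
def follows {n : ℕ} (q : Branch n) (x : Cube n) : ℝ := if ∀ c ∈ q, x c.1 = c.2 then 1 else 0

lemma follows_concat {n : ℕ} (q : Branch n) (i : Fin n) (b : ℤˣ) (x : Cube n) :
    follows (q ++ [(i, b)]) x = follows q x * if x i = b then 1 else 0 := by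
  by_cases h1 : ∀ c ∈ q, x c.1 = c.2 <;> by_cases h2 : x i = b
  · have : ∀ c ∈ q ++ [(i, b)], x c.1 = c.2 := by
      intro c hc
      rcases List.mem_append.1 hc with hc | hc
      · exact h1 c hc
      · rw [List.mem_singleton.1 hc]; exact h2
    rw [follows, follows, if_pos this, if_pos h1, if_pos h2, one_mul]
  · have : ¬ ∀ c ∈ q ++ [(i, b)], x c.1 = c.2 := fun h => h2 (h (i, b) (by simp))
    rw [follows, if_neg this, if_neg h2, mul_zero]
  all_goals
    have : ¬ ∀ c ∈ q ++ [(i, b)], x c.1 = c.2 := fun h => h1 fun c hc => h c (by simp [hc])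
    rw [follows, follows, if_neg this, if_neg h1, zero_mul]

/-- A repeated coordinate multiplies the weight by 1 or 0, according to whether the prescriptions
agree, and a new one by 1/2. Hence the weight is only known to be 2^{-|q|} on branches without
repetition. -/
lemma exists_expect_follows {n : ℕ} (q : Branch n) : ∃ w : ℝ, 0 ≤ w ∧
    ((q.map Prod.fst).Nodup → w = (1 / 2) ^ q.length) ∧
    ∀ F : Cube n → ℝ, 𝔼 x, follows q x * F x = w * 𝔼 x, F (assign q x) := by
  induction q using List.reverseRecOn with
  | nil => exact ⟨1, zero_le_one, by simp, fun F => by simp [follows, assign]⟩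
  | append_singleton q c ih =>
    obtain ⟨i, b⟩ := c
    obtain ⟨w, hw, hwn, h⟩ := ih
    have hF : ∀ F : Cube n → ℝ, 𝔼 x, follows (q ++ [(i, b)]) x * F x =
        w * 𝔼 x, (if assign q x i = b then 1 else 0) * F (assign q x) := by
      intro F
      simp only [follows_concat, mul_assoc]
      exact h fun x => (if x i = b then 1 else 0) * F x
    have ha : ∀ x, assign (q ++ [(i, b)]) x = assign q (Function.update x i b) := by
      intro x; simp [assign]
    by_cases hi : i ∈ q.map Prod.fst
    · obtain ⟨c, hc⟩ := exists_assign_eq hi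
      refine ⟨w * if c = b then 1 else 0, by positivity, ?_, ?_⟩
      · intro hn
        rw [List.map_append, List.nodup_append] at hn
        exact absurd rfl (hn.2.2 i hi i (by simp))
      · intro F
        rw [hF]
        simp only [hc, ha, assign_update_of_mem hi, ← Finset.mul_expect]
        ring
    · refine ⟨w * (1 / 2), by positivity, ?_, ?_⟩
      · intro hn
        rw [List.map_append] at hn
        rw [hwn hn.of_append_left, List.length_append, List.length_singleton, pow_succ]
      · intro F
        rw [hF]
        simp only [assign_of_notMem hi, ha]
        rw [expect_split _ i]
        rcases Int.units_eq_one_or b with rfl | rfl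
        · simp [Function.update_self]
          ring
        · simp [Function.update_self]
          ring

/-- This keeps the greedy rule from repeating a coordinate on a branch whenever the best influence
is positive. -/
lemma noisyInf_subfn_of_mem {n : ℕ} (δ d : ℝ) (f : Cube n → ℤˣ) {q : Branch n} {i : Fin n}
    (h : i ∈ q.map Prod.fst) : noisyInf δ d (subfn f q) i = 0 := by
  have e : fixCoord (subfn f q) i 1 = subfn f q := by
    ext x
    simp only [fixCoord, subfn_eq, assign_update_of_mem h]
  refine Finset.sum_eq_zero fun S hS => ?_
  rw [← e, fhat_fixCoord_of_mem _ _ (Finset.mem_filter.1 hS).2.1]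
  ring

/-! ### Leaves -/

lemma length_leaves {n : ℕ} {α : Type} (T : DecTree n α) : T.leaves.length = T.size := by
  induction T with
  | leaf a => rfl
  | node i a b iha ihb => simp [DecTree.leaves, DecTree.size, iha, ihb]

lemma size_pos {n : ℕ} {α : Type} (T : DecTree n α) : 1 ≤ T.size := by
  induction T with
  | leaf a => exact le_rfl
  | node i a b iha ihb => simp only [DecTree.size]; omega

lemma length_lt_size {n : ℕ} {α : Type} (T : DecTree n α) : ∀ p ∈ T.leaves, p.length < T.size := by
  induction T with
  | leaf a => simp [DecTree.leaves, DecTree.size]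
  | node i a b iha ihb =>
    intro p hp
    have := size_pos a
    have := size_pos b
    simp only [DecTree.leaves, List.mem_append, List.mem_map] at hp
    simp only [DecTree.size]
    rcases hp with ⟨q, hq, rfl⟩ | ⟨q, hq, rfl⟩
    · have := iha q hq; simp only [List.length_cons]; omega
    · have := ihb q hq; simp only [List.length_cons]; omega

lemma leaves_split {n : ℕ} (i : Fin n) (T : PTree n) : ∀ p ∈ T.leaves, ∃ l₁ l₂,
    T.leaves = l₁ ++ p :: l₂ ∧
    (T.split p i).leaves = l₁ ++ (p ++ [(i, -1)]) :: (p ++ [(i, 1)]) :: l₂ := by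
  induction T with
  | leaf a =>
    intro p hp
    simp only [DecTree.leaves, List.mem_singleton] at hp
    subst hp
    exact ⟨[], [], rfl, rfl⟩
  | node j a b iha ihb =>
    intro p hp
    simp only [DecTree.leaves, List.mem_append, List.mem_map] at hp
    rcases hp with ⟨q, hq, rfl⟩ | ⟨q, hq, rfl⟩
    · obtain ⟨l₁, l₂, h₁, h₂⟩ := iha q hq
      refine ⟨l₁.map ((j, -1) :: ·), l₂.map ((j, -1) :: ·) ++ b.leaves.map ((j, 1) :: ·), ?_, ?_⟩
      · simp [DecTree.leaves, h₁]
      · simp [DecTree.leaves, DecTree.split, h₂]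
    · obtain ⟨l₁, l₂, h₁, h₂⟩ := ihb q hq
      refine ⟨a.leaves.map ((j, -1) :: ·) ++ l₁.map ((j, 1) :: ·), l₂.map ((j, 1) :: ·), ?_, ?_⟩
      · simp [DecTree.leaves, h₁]
      · have : (1 : ℤˣ) ≠ -1 := by decide
        simp [DecTree.leaves, DecTree.split, h₂, this]

lemma size_completion {n : ℕ} (P : PTree n) : ∀ f : Cube n → ℤˣ, (completion f P).size = P.size := by
  induction P with
  | leaf a => exact fun _ => rfl
  | node i a b iha ihb => intro f; simp [completion, DecTree.size, iha, ihb]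

/-- The expectation, over a random walk from the root, of a function of the leaf reached. -/
def leafAvg {n : ℕ} (P : PTree n) (F : Branch n → ℝ) : ℝ :=
  (P.leaves.map fun p => (1 / 2) ^ p.length * F p).sum

lemma leafAvg_node {n : ℕ} (i : Fin n) (a b : PTree n) (F : Branch n → ℝ) :
    leafAvg (.node i a b) F =
      (leafAvg a (fun p => F ((i, -1) :: p)) + leafAvg b fun p => F ((i, 1) :: p)) / 2 := by
  have h : ∀ (l : List (Branch n)) (c : ℤˣ),
      ((l.map ((i, c) :: ·)).map fun p => (1 / 2 : ℝ) ^ p.length * F p).sum =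
        (l.map fun p => (1 / 2 : ℝ) ^ p.length * F ((i, c) :: p)).sum / 2 := by
    intro l c
    rw [List.map_map, ← mul_one_div (List.sum _), ← List.sum_map_mul_right]
    congr 1
    refine List.map_congr_left fun p _ => ?_
    simp only [Function.comp, List.length_cons, pow_succ]
    ring
  simp only [leafAvg, DecTree.leaves, List.map_append, List.sum_append, h]
  ring

/-- The submartingale property along the random walk down the tree; the induction carries the path q
already walked. -/
lemma le_leafAvg {n : ℕ} (P : PTree n) (F : Branch n → ℝ)
    (hF : ∀ p i, F p ≤ (F (p ++ [(i, -1)]) + F (p ++ [(i, 1)])) / 2) : F [] ≤ leafAvg P F := by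
  suffices h : ∀ q, F q ≤ leafAvg P fun p => F (q ++ p) from h []
  induction P with
  | leaf a => intro q; simp [leafAvg, DecTree.leaves]
  | node i a b iha ihb =>
    intro q
    rw [leafAvg_node]
    have h1 := iha (q ++ [(i, -1)])
    have h2 := ihb (q ++ [(i, 1)])
    simp only [List.append_assoc, List.singleton_append] at h1 h2
    linarith [hF q i]

lemma leafAvg_mono {n : ℕ} (P : PTree n) {F G : Branch n → ℝ} (h : ∀ p ∈ P.leaves, F p ≤ G p) :
    leafAvg P F ≤ leafAvg P G := by
  refine List.sum_le_sum fun p hp => ?_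
  exact mul_le_mul_of_nonneg_left (h p hp) (by positivity)

lemma leafAvg_add {n : ℕ} (P : PTree n) (F G : Branch n → ℝ) :
    leafAvg P (fun p => F p + G p) = leafAvg P F + leafAvg P G := by
  simp only [leafAvg, mul_add, List.sum_map_add]

lemma leafAvg_const_mul {n : ℕ} (P : PTree n) (a : ℝ) (F : Branch n → ℝ) :
    leafAvg P (fun p => a * F p) = a * leafAvg P F := by
  simp only [leafAvg, ← List.sum_map_mul_left]
  congr 1
  exact List.map_congr_left fun p _ => by ring

lemma leafAvg_split {n : ℕ} {P : PTree n} {p : Branch n} (hp : p ∈ P.leaves) (i : Fin n)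
    (F : Branch n → ℝ) : leafAvg (P.split p i) F = leafAvg P F + (1 / 2) ^ p.length *
      ((F (p ++ [(i, -1)]) + F (p ++ [(i, 1)])) / 2 - F p) := by
  obtain ⟨l₁, l₂, h₁, h₂⟩ := leaves_split i P p hp
  simp only [leafAvg, h₁, h₂, List.map_append, List.map_cons, List.sum_append, List.sum_cons,
    List.length_append, List.length_singleton, pow_succ]
  ring

/-! ### The error of a completion -/

/-- The probability of following a branch to an input that its label misclassifies. -/
def leafErr {n : ℕ} (f : Cube n → ℤˣ) (q : Branch n) : ℝ :=
  𝔼 x, follows q x * if f x ≠ signOf (avg (subfn f q)) then (1 : ℝ) else 0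

lemma expect_follows_completion {n : ℕ} (f : Cube n → ℤˣ) (P : PTree n) : ∀ q : Branch n,
    𝔼 x, follows q x * (if f x ≠ (completion (subfn f q) P).eval x then (1 : ℝ) else 0) =
      (P.leaves.map fun p => leafErr f (q ++ p)).sum := by
  induction P with
  | leaf a => intro q; simp [DecTree.leaves, leafErr, completion, DecTree.eval]
  | node i a b iha ihb =>
    intro q
    have h1 := iha (q ++ [(i, -1)])
    have h2 := ihb (q ++ [(i, 1)])
    simp only [List.append_assoc, List.singleton_append] at h1 h2
    simp only [DecTree.leaves, List.map_append, List.map_map, List.sum_append, Function.comp_def]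
    rw [← h1, ← h2, ← Finset.expect_add_distrib]
    refine Finset.expect_congr rfl fun x _ => ?_
    simp only [follows_concat, subfn_concat, completion, DecTree.eval]
    have h3 : (1 : ℤˣ) ≠ -1 := by decide
    rcases Int.units_eq_one_or (x i) with hx | hx
    · simp [hx, h3]
    · simp [hx, h3.symm]

lemma err_completion {n : ℕ} (f : Cube n → ℤˣ) (P : PTree n) :
    err f (completion f P) = (P.leaves.map (leafErr f)).sum := by
  have h := expect_follows_completion f P []
  simp only [subfn, List.nil_append] at h
  rw [← h, err, disagree]
  refine Finset.expect_congr rfl fun x _ => ?_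
  have h1 : follows [] x = 1 := by simp [follows]
  rw [h1, one_mul]
  congr 1

lemma disagree_const {n : ℕ} (f : Cube n → ℤˣ) (c : ℤˣ) :
    disagree f (fun _ => c) = (1 - avg f * sgnVal c) / 2 := by
  simp only [disagree, ite_ne_eq, ← Finset.expect_div, Finset.expect_sub_distrib, expect_const',
    ← Finset.expect_mul]
  rfl

lemma disagree_signOf {n : ℕ} (f : Cube n → ℤˣ) :
    disagree f (fun _ => signOf (avg f)) = constErr f := by
  rw [disagree_const, constErr, signOf]
  split_ifs with h
  · rw [abs_of_nonneg h, sgnVal_one, mul_one]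
  · rw [abs_of_neg (not_le.1 h), sgnVal_neg_one, mul_neg_one]

lemma constErr_le_disagree {n : ℕ} (f : Cube n → ℤˣ) (c : ℤˣ) :
    constErr f ≤ disagree f fun _ => c := by
  rw [disagree_const, constErr]
  rcases Int.units_eq_one_or c with rfl | rfl
  · rw [sgnVal_one]; linarith [le_abs_self (avg f)]
  · rw [sgnVal_neg_one]; linarith [neg_abs_le (avg f)]

lemma expect_follows_ne {n : ℕ} (f : Cube n → ℤˣ) (q : Branch n) : ∃ w : ℝ, 0 ≤ w ∧
    ((q.map Prod.fst).Nodup → w = (1 / 2) ^ q.length) ∧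
    ∀ c : ℤˣ, 𝔼 x, follows q x * (if f x ≠ c then (1 : ℝ) else 0) =
      w * disagree (subfn f q) fun _ => c := by
  obtain ⟨w, hw, hn, h⟩ := exists_expect_follows q
  refine ⟨w, hw, hn, fun c => ?_⟩
  rw [h, subfn_eq]
  rfl

lemma leafErr_of_nodup {n : ℕ} (f : Cube n → ℤˣ) {q : Branch n} (h : (q.map Prod.fst).Nodup) :
    leafErr f q = (1 / 2) ^ q.length * constErr (subfn f q) := by
  obtain ⟨w, hw, hn, h'⟩ := expect_follows_ne f q
  rw [leafErr, h', hn h, disagree_signOf]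

lemma leafErr_le {n : ℕ} (f : Cube n → ℤˣ) (q : Branch n) (c : ℤˣ) :
    leafErr f q ≤ 𝔼 x, follows q x * if f x ≠ c then (1 : ℝ) else 0 := by
  obtain ⟨w, hw, hn, h'⟩ := expect_follows_ne f q
  rw [leafErr, h', h', disagree_signOf]
  exact mul_le_mul_of_nonneg_left (constErr_le_disagree _ _) hw

/-- Both children may keep the label of the parent, and the majority label is at least as good.
Since `leafErr` uses actual probabilities, this also covers branches that repeat a coordinate. -/
lemma leafErr_split_le {n : ℕ} (f : Cube n → ℤˣ) (q : Branch n) (i : Fin n) :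
    leafErr f (q ++ [(i, -1)]) + leafErr f (q ++ [(i, 1)]) ≤ leafErr f q := by
  have h1 := leafErr_le f (q ++ [(i, -1)]) (signOf (avg (subfn f q)))
  have h2 := leafErr_le f (q ++ [(i, 1)]) (signOf (avg (subfn f q)))
  refine (add_le_add h1 h2).trans_eq ?_
  rw [← Finset.expect_add_distrib, leafErr]
  refine Finset.expect_congr rfl fun x _ => ?_
  simp only [follows_concat]
  have h3 : (1 : ℤˣ) ≠ -1 := by decide
  rcases Int.units_eq_one_or (x i) with hx | hx
  · simp [hx, h3]
  · simp [hx, h3.symm]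

lemma err_completion_split_le {n : ℕ} (f : Cube n → ℤˣ) {P : PTree n} {p : Branch n}
    (hp : p ∈ P.leaves) (i : Fin n) :
    err f (completion f (P.split p i)) ≤ err f (completion f P) := by
  obtain ⟨l₁, l₂, h₁, h₂⟩ := leaves_split i P p hp
  simp only [err_completion, h₁, h₂, List.map_append, List.map_cons, List.sum_append, List.sum_cons]
  linarith [leafErr_split_le f p i]

/-- No branch of the tree queries a coordinate twice. -/
def ReadOnce {n : ℕ} (P : PTree n) : Prop := ∀ p ∈ P.leaves, (p.map Prod.fst).Nodup

lemma ReadOnce.err_completion {n : ℕ} {P : PTree n} (h : ReadOnce P) (f : Cube n → ℤˣ) :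
    err f (completion f P) = leafAvg P fun p => constErr (subfn f p) := by
  rw [StabDT.err_completion, leafAvg]
  congr 1
  exact List.map_congr_left fun p hp => leafErr_of_nodup f (h p hp)

/-! ### The average score of the leaves of an inaccurate tree -/

/-- The largest noisy influence. -/
def maxInf {n : ℕ} (δ d : ℝ) (f : Cube n → ℤˣ) : ℝ := ⨆ i, noisyInf δ d f i

lemma noisyInf_le_maxInf {n : ℕ} (δ d : ℝ) (f : Cube n → ℤˣ) (i : Fin n) :
    noisyInf δ d f i ≤ maxInf δ d f :=
  le_ciSup (f := fun i => noisyInf δ d f i) (Set.finite_range _).bddAbove i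

lemma maxInf_eq {n : ℕ} {δ d : ℝ} {f : Cube n → ℤˣ} {i : Fin n}
    (h : ∀ j, noisyInf δ d f j ≤ noisyInf δ d f i) : maxInf δ d f = noisyInf δ d f i := by
  have : Nonempty (Fin n) := ⟨i⟩
  exact le_antisymm (ciSup_le h) (noisyInf_le_maxInf δ d f i)

lemma maxInf_nonneg {n : ℕ} {δ : ℝ} (h1 : δ < 1) (d : ℝ) (f : Cube n → ℤˣ) : 0 ≤ maxInf δ d f :=
  Real.iSup_nonneg fun i => noisyInf_nonneg h1 d f i

lemma Computed.subfn {n : ℕ} {D s : ℕ} (p : Branch n) : ∀ {k : Cube n → ℤˣ}, Computed k D s →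
    Computed (subfn k p) D s := by
  induction p with
  | nil => exact fun h => h
  | cons c p ih => exact fun h => ih (h.fixCoord c.1 c.2)

lemma leafAvg_disagree_le {n : ℕ} (f k : Cube n → ℤˣ) (P : PTree n) :
    leafAvg P (fun p => disagree (subfn f p) (subfn k p)) ≤ disagree f k := by
  have h := le_leafAvg P (fun p => -1 * disagree (subfn f p) (subfn k p)) (by
    intro p i
    rw [disagree_split (subfn f p) (subfn k p) i]
    simp only [subfn_concat]
    linarith)
  rw [leafAvg_const_mul] at h
  simp only [subfn] at h
  linarith

/-- Restriction increases stability on average, by `stab_split` with its influence term dropped. -/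
lemma leafAvg_noiseSens_le {n : ℕ} {δ : ℝ} (h0 : 0 < δ) (h1 : δ < 1) (f : Cube n → ℤˣ)
    (P : PTree n) : leafAvg P (fun p => noiseSens δ (subfn f p)) ≤ noiseSens δ f := by
  have h := le_leafAvg P (fun p => -1 * noiseSens δ (subfn f p)) (by
    intro p i
    have h2 := stab_split h0 h1 0 (subfn f p) i
    have h3 := mul_nonneg h0.le (noisyInf_nonneg h1 0 (subfn f p) i)
    simp only [subfn_concat, noiseSens_eq]
    linarith)
  rw [leafAvg_const_mul] at h
  simp only [subfn] at h
  linarith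

lemma ReadOnce.err_le {n : ℕ} {δ ε : ℝ} (h0 : 0 < δ) (h1 : δ < 1) (hε : 0 < ε)
    (hε' : ε < 1 / 2) {P : PTree n} (hP : ReadOnce P) (f k : Cube n → ℤˣ) {D s : ℕ} (hD : 1 ≤ D)
    (hk : Computed k D s) :
    5 / 4 * err f (completion f P) ≤ 13 * (disagree f k + noiseSens δ f) +
      4 * D * Real.logb 2 s * leafAvg P fun p => maxInf δ (degBound δ ε) (subfn f p) := by
  have h := leafAvg_mono P (F := fun p => 5 / 4 * constErr (subfn f p))
    (G := fun p => 13 * (disagree (subfn f p) (subfn k p) + noiseSens δ (subfn f p)) +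
      4 * D * Real.logb 2 s * maxInf δ (degBound δ ε) (subfn f p)) (by
    intro p _
    linarith [constErr_sub_le h0 h1 hε hε' (subfn f p) (subfn k p) hD (hk.subfn p)
      (maxInf_nonneg h1 _ _) (noisyInf_le_maxInf δ (degBound δ ε) (subfn f p))])
  rw [leafAvg_add, leafAvg_const_mul, leafAvg_const_mul, leafAvg_const_mul, leafAvg_add] at h
  rw [hP.err_completion]
  linarith [leafAvg_disagree_le f k P, leafAvg_noiseSens_le h0 h1 f P]

/-! ### A shallow comparison tree, and the resulting lower bound on scores. -/

lemma exists_tree_of_size {n : ℕ} [NeZero n] (s : ℕ) (hs : 1 ≤ s) : ∃ T : DTree n, T.size = s := by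
  induction s, hs using Nat.le_induction with
  | base => exact ⟨.leaf 1, rfl⟩
  | succ s _ ih =>
    obtain ⟨T, hT⟩ := ih
    exact ⟨.node 0 (.leaf 1) T, by simp [DecTree.size, hT, add_comm]⟩

lemma opt_nonneg {n : ℕ} (f : Cube n → ℤˣ) (s : ℕ) : 0 ≤ opt f s :=
  Real.sInf_nonneg (by rintro e ⟨T, _, rfl⟩; exact disagree_nonneg _ _)

lemma exists_tree_err_lt {n : ℕ} [NeZero n] (f : Cube n → ℤˣ) {s : ℕ} (hs : 1 ≤ s) {κ : ℝ}
    (hκ : 0 < κ) : ∃ T : DTree n, T.size = s ∧ err f T < opt f s + κ := by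
  obtain ⟨T₀, h₀⟩ := exists_tree_of_size (n := n) s hs
  obtain ⟨e, ⟨T, hT, rfl⟩, h⟩ := exists_lt_of_csInf_lt
    (s := {e : ℝ | ∃ T : DTree n, T.size = s ∧ e = err f T}) ⟨_, T₀, h₀, rfl⟩
    (b := opt f s + κ) (by rw [opt]; linarith)
  exact ⟨T, hT, h⟩

/-- The size `s`, restricted to the interval from `2` to `2 ^ n`. -/
def effSize (n s : ℕ) : ℕ := min (max s 2) (2 ^ n)

lemma two_le_effSize (n s : ℕ) [NeZero n] : 2 ≤ effSize n s := by
  refine le_min (le_max_right _ _) ?_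
  calc 2 = 2 ^ 1 := rfl
    _ ≤ 2 ^ n := Nat.pow_le_pow_right (by norm_num) (NeZero.one_le)

lemma two_le_logb_div {s : ℕ} (hs : 2 ≤ s) {ε : ℝ} (hε : 0 < ε) (hε' : ε < 1 / 2) :
    2 ≤ Real.logb 2 (s / ε) := by
  have hs' : (2 : ℝ) ≤ s := by exact_mod_cast hs
  rw [Real.le_logb_iff_rpow_le (by norm_num) (by positivity), le_div_iff₀ hε]
  norm_num
  nlinarith

lemma exists_computed_near {n : ℕ} [NeZero n] (f : Cube n → ℤˣ) {s : ℕ} (hs : 1 ≤ s) {κ ε : ℝ}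
    (hκ : 0 < κ) (hε : 0 < ε) (hε' : ε < 1 / 2) : ∃ (k : Cube n → ℤˣ) (D : ℕ), 1 ≤ D ∧
    (D : ℝ) ≤ 7 / 2 * Real.logb 2 (effSize n s / ε) ∧ Computed k D (effSize n s) ∧
    disagree f k ≤ opt f s + κ + ε / 16 := by
  have h2 := two_le_effSize n s
  have hL := two_le_logb_div h2 hε hε'
  have hs2 : (2 : ℝ) ≤ effSize n s := by exact_mod_cast h2
  -- Past size 2^n, f itself is computed at depth n. Capping the size there keeps the logarithms in
  -- `scoreBound` polynomial in n whatever s is.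
  rcases le_total (2 ^ n) (max s 2) with h | h
  · have he : effSize n s = 2 ^ n := min_eq_right h
    refine ⟨f, n, NeZero.one_le, ?_, he ▸ computed_self f, ?_⟩
    · have : Real.logb 2 (effSize n s) ≤ Real.logb 2 (effSize n s / ε) := by
        apply Real.logb_le_logb_of_le (by norm_num) (by linarith)
        rw [le_div_iff₀ hε]; nlinarith
      have e : Real.logb 2 (effSize n s) = n := by
        rw [he]; push_cast
        rw [Real.logb_pow, Real.logb_self_eq_one (by norm_num), mul_one]
      linarith
    · have : disagree f f = 0 := by simp [disagree]
      have := opt_nonneg f s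
      linarith
  · have he : effSize n s = max s 2 := min_eq_left h
    have hse : s ≤ effSize n s := he ▸ le_max_left _ _
    obtain ⟨T, hT, hTe⟩ := exists_tree_err_lt f hs hκ
    obtain ⟨D₀, hD₀⟩ := exists_computed_eval T
    rw [hT] at hD₀
    have hlog : Real.logb 2 (16 * (effSize n s / ε)) = 4 + Real.logb 2 (effSize n s / ε) := by
      rw [Real.logb_mul (by norm_num) (by positivity), show (16 : ℝ) = 2 ^ 4 by norm_num,
        Real.logb_pow, Real.logb_self_eq_one (by norm_num)]
      norm_num
    have hc := Nat.ceil_lt_add_one (a := Real.logb 2 (16 * (effSize n s / ε))) (by linarith)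
    have hc' := Nat.le_ceil (Real.logb 2 (16 * (effSize n s / ε)))
    obtain ⟨k, hk, hd⟩ := hD₀.truncate ⌈Real.logb 2 (16 * (effSize n s / ε))⌉₊
    -- Cutting at depth ⌈log(16 s/ε)⌉ costs at most ε/16. With L = log(s/ε) ≥ 2 for the clamped
    -- size, this depth is below L + 5 ≤ 7L/2.
    refine ⟨k, _, ?_, ?_, hk.mono le_rfl hse, ?_⟩
    · rw [Nat.one_le_ceil_iff]; linarith
    · linarith
    · have h3 : 16 * (effSize n s / ε) ≤ 2 ^ ⌈Real.logb 2 (16 * (effSize n s / ε))⌉₊ := by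
        rw [Real.logb_le_iff_le_rpow (by norm_num) (by positivity)] at hc'
        exact_mod_cast hc'
      have h4 : (s : ℝ) / 2 ^ ⌈Real.logb 2 (16 * (effSize n s / ε))⌉₊ ≤ ε / 16 := by
        have hs' : (s : ℝ) ≤ effSize n s := by exact_mod_cast hse
        rw [div_le_iff₀ (by positivity)]
        calc (s : ℝ) ≤ effSize n s := hs'
          _ = ε / 16 * (16 * (effSize n s / ε)) := by field_simp
          _ ≤ _ := by gcongr
      have := disagree_triangle f T.eval k
      rw [err] at hTe
      linarith

/-- A lower bound on the average score of the leaves of an inaccurate tree. -/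
def scoreBound (n s : ℕ) (ε : ℝ) : ℝ :=
  ε / (40 * Real.logb 2 (effSize n s) * Real.logb 2 (effSize n s / ε))

lemma one_le_logb {s : ℕ} (hs : 2 ≤ s) : 1 ≤ Real.logb 2 s := by
  have hs' : (2 : ℝ) ≤ s := by exact_mod_cast hs
  rw [Real.le_logb_iff_rpow_le (by norm_num) (by positivity)]
  simpa using hs'

lemma scoreBound_pos (n s : ℕ) [NeZero n] {ε : ℝ} (hε : 0 < ε) (hε' : ε < 1 / 2) :
    0 < scoreBound n s ε := by
  have h1 := one_le_logb (two_le_effSize n s)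
  have h2 := two_le_logb_div (two_le_effSize n s) hε hε'
  unfold scoreBound
  positivity

lemma ReadOnce.scoreBound_le {n : ℕ} [NeZero n] {δ ε κ : ℝ} (h0 : 0 < δ) (h1 : δ < 1) (hε : 0 < ε)
    (hε' : ε < 1 / 2) (hκ : 0 < κ) {P : PTree n} (hP : ReadOnce P) {f : Cube n → ℤˣ}
    (hf : noiseSens δ f ≤ κ) {s : ℕ} (hs : 1 ≤ s)
    (herr : 24 * (opt f s + κ) + ε < err f (completion f P)) :
    scoreBound n s ε ≤ leafAvg P fun p => maxInf δ (degBound δ ε) (subfn f p) := by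
  obtain ⟨k, D, hD1, hD, hk, hd⟩ := exists_computed_near f hs hκ hε hε'
  have h := hP.err_le h0 h1 hε hε' f k hD1 hk
  have hL0 : 0 ≤ leafAvg P fun p => maxInf δ (degBound δ ε) (subfn f p) :=
    List.sum_nonneg (by
      intro a ha
      obtain ⟨p, _, rfl⟩ := List.mem_map.1 ha
      exact mul_nonneg (by positivity) (maxInf_nonneg h1 _ _))
  set L := leafAvg P fun p => maxInf δ (degBound δ ε) (subfn f p)
  have l1 := one_le_logb (two_le_effSize n s)
  have l2 := two_le_logb_div (two_le_effSize n s) hε hε'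
  have ho := opt_nonneg f s
  rw [scoreBound, div_le_iff₀ (by positivity)]
  -- In the error bound, 5/4 · 24 = 30 exceeds the losses 13 in `opt` and 26 in κ. Of ε, 5/4 - 13/16
  -- = 7/16 remains, against 14 times the two logarithms and L; this would allow 32 in place of 40
  -- in `scoreBound`.
  have h3 : 4 * D * Real.logb 2 (effSize n s) * L ≤
      4 * (7 / 2 * Real.logb 2 (effSize n s / ε)) * Real.logb 2 (effSize n s) * L := by gcongr
  nlinarith

/-! ### The greedy process -/

lemma Step.size {n : ℕ} {δ d : ℝ} {f : Cube n → ℤˣ} {P P' : PTree n} (h : Step δ d f P P') :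
    P'.size = P.size + 1 := by
  obtain ⟨p, hp, i, -, -, rfl⟩ := h
  obtain ⟨l₁, l₂, h₁, h₂⟩ := leaves_split i P p hp
  rw [← length_leaves, ← length_leaves, h₁, h₂]
  simp only [List.length_append, List.length_cons]
  omega

lemma Step.err_le {n : ℕ} {δ d : ℝ} {f : Cube n → ℤˣ} {P P' : PTree n} (h : Step δ d f P P') :
    err f (completion f P') ≤ err f (completion f P) := by
  obtain ⟨p, hp, i, -, -, rfl⟩ := h
  exact err_completion_split_le f hp i

/-- The error that the algorithm has to reach. -/
def goalErr {n : ℕ} (f : Cube n → ℤˣ) (s : ℕ) (κ ε : ℝ) : ℝ := 24 * (opt f s + κ) + ε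

/-- What holds of the trees built as long as the error is too large. -/
structure Good {n : ℕ} (f : Cube n → ℤˣ) (δ κ γ : ℝ) (P : PTree n) : Prop where
  readOnce : ReadOnce P
  potential : 1 - 2 * κ + δ * γ * Real.log P.size ≤ leafAvg P fun p => stab δ (subfn f p)
  depth : ∀ p ∈ P.leaves, p ≠ [] → 2 ^ p.length * γ ≤ 2 * P.size

lemma good_leaf {n : ℕ} {f : Cube n → ℤˣ} {δ κ : ℝ} (hf : noiseSens δ f ≤ κ) (γ : ℝ) :
    Good f δ κ γ (.leaf ()) where
  readOnce := by simp [ReadOnce, DecTree.leaves]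
  potential := by
    rw [noiseSens_eq] at hf
    simp only [DecTree.size, leafAvg, DecTree.leaves, subfn, List.map_cons, List.map_nil,
      List.sum_cons, List.sum_nil, List.length_nil, pow_zero, Nat.cast_one, Real.log_one]
    linarith
  depth := by simp [DecTree.leaves]

lemma leafAvg_maxInf_le {n : ℕ} {δ d : ℝ} {f : Cube n → ℤˣ} {P : PTree n} {a : ℝ}
    (h : ∀ q ∈ P.leaves, leafScore δ d f q ≤ a) :
    leafAvg P (fun p => maxInf δ d (subfn f p)) ≤ P.size * a := by
  have := List.sum_le_card_nsmul (P.leaves.map (leafScore δ d f)) a (by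
    intro x hx
    obtain ⟨q, hq, rfl⟩ := List.mem_map.1 hx
    exact h q hq)
  rw [List.length_map, length_leaves, nsmul_eq_mul] at this
  exact this

lemma log_succ_sub_le {m : ℕ} (hm : 1 ≤ m) : Real.log (m + 1 : ℕ) ≤ Real.log m + 1 / m := by
  have hm' : (0 : ℝ) < m := by exact_mod_cast hm
  have h := Real.log_le_sub_one_of_pos (x := ((m + 1 : ℕ) : ℝ) / m) (by positivity)
  rw [Real.log_div (by positivity) hm'.ne'] at h
  have e : ((m + 1 : ℕ) : ℝ) / m - 1 = 1 / m := by push_cast; field_simp; ring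
  linarith

/-- Everything follows from the chosen score being at least γ/m. It is positive, so the query is
new; it raises the potential by at least δγ/m, which covers the increase of δγ ln m; and since
influences are at most 1, the split leaf has 2^{-|p|} ≥ γ/m. The factor 2 in `depth` pays for the
extra level of its children. -/
lemma Good.step {n : ℕ} {f : Cube n → ℤˣ} {δ κ γ d : ℝ} {P P' : PTree n} (h0 : 0 < δ) (h1 : δ < 1)
    (hγ : 0 < γ) (hP : Good f δ κ γ P) (hs : Step δ d f P P')
    (hL : γ ≤ leafAvg P fun p => maxInf δ d (subfn f p)) : Good f δ κ γ P' := by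
  have hsize := hs.size
  obtain ⟨p, hp, i, hmax, hi, rfl⟩ := hs
  have hpos : (0 : ℝ) < P.size := by exact_mod_cast size_pos P
  have hscore : γ / P.size ≤ (1 / 2) ^ p.length * noisyInf δ d (subfn f p) i := by
    rw [div_le_iff₀ hpos, ← maxInf_eq hi, mul_comm]
    exact hL.trans (leafAvg_maxInf_le hmax)
  have hinf : 0 < noisyInf δ d (subfn f p) i := by
    by_contra h
    have := mul_nonpos_of_nonneg_of_nonpos (a := (1 / 2 : ℝ) ^ p.length) (by positivity)
      (not_lt.1 h)
    have : 0 < γ / P.size := by positivity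
    linarith
  have hip : i ∉ p.map Prod.fst := fun h => hinf.ne' (noisyInf_subfn_of_mem δ d f h)
  have hmem : ∀ q ∈ (P.split p i).leaves, q ∈ P.leaves ∨ ∃ b, q = p ++ [(i, b)] := by
    obtain ⟨l₁, l₂, h₁, h₂⟩ := leaves_split i P p hp
    intro q hq
    rw [h₂] at hq
    simp only [List.mem_append, List.mem_cons] at hq
    rw [h₁]
    simp only [List.mem_append, List.mem_cons]
    rcases hq with hq | hq | hq | hq
    · exact .inl (.inl hq)
    · exact .inr ⟨_, hq⟩
    · exact .inr ⟨_, hq⟩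
    · exact .inl (.inr (.inr hq))
  refine ⟨?_, ?_, ?_⟩
  · intro q hq
    rcases hmem q hq with hq | ⟨b, rfl⟩
    · exact hP.readOnce q hq
    · rw [List.map_append, List.map_cons, List.map_nil, List.nodup_append]
      refine ⟨hP.readOnce p hp, List.nodup_singleton _, ?_⟩
      rintro j hj k hk rfl
      rw [List.mem_singleton.1 hk] at hj
      exact hip hj
  · rw [leafAvg_split hp, hsize]
    have hst := stab_split h0 h1 d (subfn f p) i
    have h2 : (1 / 2) ^ p.length * (δ * noisyInf δ d (subfn f p) i) ≤ (1 / 2) ^ p.length *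
        ((stab δ (fixCoord (subfn f p) i (-1)) + stab δ (fixCoord (subfn f p) i 1)) / 2 -
          stab δ (subfn f p)) := mul_le_mul_of_nonneg_left (by linarith) (by positivity)
    simp only [subfn_concat]
    have h3 := mul_le_mul_of_nonneg_left hscore h0.le
    have h4 := mul_le_mul_of_nonneg_left (log_succ_sub_le (size_pos P)) (mul_pos h0 hγ).le
    have e : δ * γ * (Real.log P.size + 1 / P.size) =
      δ * γ * Real.log P.size + δ * (γ / P.size) := by ring
    have := hP.potential
    linarith
  · intro q hq hne
    rw [hsize]
    push_cast
    rcases hmem q hq with hq | ⟨b, rfl⟩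
    · linarith [hP.depth q hq hne]
    · have h2 : γ / P.size ≤ (1 / 2) ^ p.length :=
        hscore.trans (mul_le_of_le_one_right (by positivity) (noisyInf_le_one h0 h1 d _ i))
      have h3 : 2 ^ p.length * γ ≤ P.size := by
        rw [div_le_iff₀ hpos, one_div, inv_pow] at h2
        have h5 : (0 : ℝ) < 2 ^ p.length := by positivity
        calc 2 ^ p.length * γ ≤ 2 ^ p.length * ((2 ^ p.length)⁻¹ * P.size) := by gcongr
          _ = P.size := by field_simp
      rw [List.length_append, List.length_singleton, pow_succ]
      linarith

/-- The first alternative persists because splits never increase the error. The second is only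
propagated from trees whose error is still too large, where the score bound is available. -/
lemma err_le_or_good {n : ℕ} [NeZero n] {δ ε κ : ℝ} (h0 : 0 < δ) (h1 : δ < 1) (hε : 0 < ε)
    (hε' : ε < 1 / 2) (hκ : 0 < κ) {f : Cube n → ℤˣ} (hf : noiseSens δ f ≤ κ) {s : ℕ}
    (hs : 1 ≤ s) {P : PTree n}
    (hP : Relation.ReflTransGen (Step δ (degBound δ ε) f) (.leaf ()) P) :
    err f (completion f P) ≤ goalErr f s κ ε ∨ Good f δ κ (scoreBound n s ε) P := by
  induction hP with
  | refl => exact .inr (good_leaf hf _)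
  | @tail Q R _ hstep ih =>
    rcases ih with h | h
    · exact .inl (hstep.err_le.trans h)
    · by_cases he : err f (completion f Q) ≤ goalErr f s κ ε
      · exact .inl (hstep.err_le.trans he)
      · exact .inr (h.step h0 h1 (scoreBound_pos n s hε hε') hstep
          (h.readOnce.scoreBound_le h0 h1 hε hε' hκ hf hs (not_le.1 he)))

lemma leafAvg_one {n : ℕ} (P : PTree n) : leafAvg P (fun _ => (1 : ℝ)) = 1 := by
  induction P with
  | leaf a => simp [leafAvg, DecTree.leaves]
  | node i a b iha ihb => rw [leafAvg_node, iha, ihb]; norm_num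

lemma err_leaf_le {n : ℕ} [NeZero n] (f : Cube n → ℤˣ) :
    err f (completion f (.leaf ())) ≤ opt f 1 := by
  refine le_csInf ⟨_, .leaf 1, rfl, rfl⟩ ?_
  rintro e ⟨T, hT, rfl⟩
  rcases T with v | ⟨i, a, b⟩
  · change disagree f (fun _ => signOf (avg f)) ≤ disagree f fun _ => v
    rw [disagree_signOf]
    exact constErr_le_disagree f v
  · have := size_pos a
    have := size_pos b
    simp only [DecTree.size] at hT
    omega

lemma effSize_le {n s : ℕ} (hs : 2 ≤ s) : effSize n s ≤ s := by
  rw [effSize, max_eq_left hs]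
  exact min_le_left _ _

/-- Every possible output of sufficient size is accurate. -/
theorem err_le_of_reach {n : ℕ} [NeZero n] {δ ε κ : ℝ} (h0 : 0 < δ) (h1 : δ < 1) (hε : 0 < ε)
    (hε' : ε < 1 / 2) (hκ : 0 < κ) {f : Cube n → ℤˣ} (hf : noiseSens δ f ≤ κ) {s : ℕ}
    (hs : 1 ≤ s) {P : PTree n}
    (hP : Relation.ReflTransGen (Step δ (degBound δ ε) f) (.leaf ()) P)
    (ht : (s : ℝ) ^ (128 * (κ * Real.logb 2 (s / ε) / (ε * δ))) ≤ P.size) :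
    err f (completion f P) ≤ goalErr f s κ ε := by
  -- For s = 1 the size condition is void, but the initial one-leaf tree is already optimal.
  rcases hs.eq_or_lt with rfl | hs2
  · have h : err f (completion f P) ≤ err f (completion f (.leaf ())) := by
      clear ht
      induction hP with
      | refl => exact le_rfl
      | tail _ hstep ih => exact hstep.err_le.trans ih
    have h2 := err_leaf_le f
    have h3 := opt_nonneg f 1
    rw [goalErr]
    linarith
  rcases err_le_or_good h0 h1 hε hε' hκ hf hs hP with h | h
  · exact h
  exfalso
  have hs2' : (2 : ℝ) ≤ s := by exact_mod_cast hs2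
  have hpot := h.potential
  have hle := leafAvg_mono P (F := fun p => stab δ (subfn f p)) (G := fun _ => 1)
    fun p _ => stab_le_one h0 h1 _
  rw [leafAvg_one] at hle
  have hγ := scoreBound_pos n s hε hε'
  have hlog : Real.log s * (128 * (κ * Real.logb 2 (s / ε) / (ε * δ))) ≤ Real.log P.size := by
    have := Real.log_le_log (by positivity) ht
    rwa [Real.log_rpow (by linarith), mul_comm] at this
  have l1 := one_le_logb hs2
  have l2 := two_le_logb_div hs2 hε hε'
  have e1 := one_le_logb (two_le_effSize n s)
  have e2 := two_le_logb_div (two_le_effSize n s) hε hε'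
  have hse : (effSize n s : ℝ) ≤ s := by exact_mod_cast effSize_le hs2
  have hse0 : (0 : ℝ) < effSize n s := by
    have := two_le_effSize n s
    exact_mod_cast (by omega : 0 < effSize n s)
  have hγ' : ε / (40 * Real.logb 2 s * Real.logb 2 (s / ε)) ≤ scoreBound n s ε := by
    rw [scoreBound]
    have m1 : Real.logb 2 (effSize n s) ≤ Real.logb 2 s :=
      Real.logb_le_logb_of_le (by norm_num) hse0 hse
    have m2 : Real.logb 2 (effSize n s / ε) ≤ Real.logb 2 (s / ε) :=
      Real.logb_le_logb_of_le (by norm_num) (by positivity) (by gcongr)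
    gcongr
  have hln : Real.log s = Real.logb 2 s * Real.log 2 := by
    rw [Real.logb, div_mul_cancel₀]
    exact (Real.log_pos (by norm_num)).ne'
  have hl2 := Real.log_two_gt_d9
  -- The constant 128 is chosen here: 128/40 · ln 2 > 2, so the potential would have to exceed 1.
  have key : 2 * κ < δ * (ε / (40 * Real.logb 2 s * Real.logb 2 (s / ε))) *
      (Real.log s * (128 * (κ * Real.logb 2 (s / ε) / (ε * δ)))) := by
    rw [hln]
    have : δ * (ε / (40 * Real.logb 2 s * Real.logb 2 (s / ε))) *
        (Real.logb 2 s * Real.log 2 * (128 * (κ * Real.logb 2 (s / ε) / (ε * δ)))) =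
        κ * (128 / 40 * Real.log 2) := by
      field_simp
    rw [this]
    nlinarith
  have hlogs : 0 ≤ Real.log s := Real.log_nonneg (by linarith)
  have : δ * (ε / (40 * Real.logb 2 s * Real.logb 2 (s / ε))) *
      (Real.log s * (128 * (κ * Real.logb 2 (s / ε) / (ε * δ)))) ≤
      δ * scoreBound n s ε * Real.log P.size := by gcongr
  linarith

/-! ### Values computed by the program -/

@[simp] lemma Timed.val_bind {α β : Type} (m : Timed α) (g : α → Timed β) :
    (m >>= g).val = (g m.val).val := rfl

@[simp] lemma Timed.cost_bind {α β : Type} (m : Timed α) (g : α → Timed β) :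
    (m >>= g).cost = m.cost + (g m.val).cost := rfl

@[simp] lemma Timed.val_pure {α : Type} (a : α) : (pure a : Timed α).val = a := rfl

@[simp] lemma Timed.cost_pure {α : Type} (a : α) : (pure a : Timed α).cost = 0 := rfl

@[simp] lemma tick_cost (k : ℕ) : (tick k).cost = k := rfl

@[simp] lemma query_val {n : ℕ} (c : ℕ) (O : Oracle n) (p : Branch n) (S : List (Fin n)) :
    (query c O p S).val = O p S := rfl

@[simp] lemma query_cost {n : ℕ} (c : ℕ) (O : Oracle n) (p : Branch n) (S : List (Fin n)) :
    (query c O p S).cost = 2 ^ (c * p.length) + p.length + S.length := rfl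

@[simp] lemma powT_val (a : ℝ) (k : ℕ) : (powT a k).val = a ^ k := by
  induction k with
  | zero => simp [powT]
  | succ k ih => simp [powT, ih, pow_succ, mul_comm]

@[simp] lemma powT_cost (a : ℝ) (k : ℕ) : (powT a k).cost = k + 1 := by
  induction k with
  | zero => simp [powT]
  | succ k ih => simp [powT, ih]

lemma subsetsT_cons {n : ℕ} (a : Fin n) (L : List (Fin n)) {r : ℝ} (h : 1 ≤ r) :
    (subsetsT (a :: L) r).val =
      (subsetsT L (r - 1)).val.map (a :: ·) ++ (subsetsT L r).val := by
  simp [subsetsT, h]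

lemma subsetsT_cons_of_lt {n : ℕ} (a : Fin n) (L : List (Fin n)) {r : ℝ} (h : ¬ 1 ≤ r) :
    (subsetsT (a :: L) r).val = [[]] := by
  simp [subsetsT, h]

lemma sublist_of_mem_subsetsT {n : ℕ} (L : List (Fin n)) :
    ∀ r : ℝ, ∀ S ∈ (subsetsT L r).val, S.Sublist L := by
  induction L with
  | nil => intro r S hS; simp [subsetsT] at hS; simp [hS]
  | cons a L ih =>
    intro r S hS
    by_cases h : 1 ≤ r
    · rw [subsetsT_cons a L h, List.mem_append, List.mem_map] at hS
      rcases hS with ⟨S, hS, rfl⟩ | hS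
      · exact (ih _ S hS).cons_cons a
      · exact (ih _ S hS).cons a
    · rw [subsetsT_cons_of_lt a L h, List.mem_singleton] at hS
      simp [hS]

/-- Sets containing the head a are enumerated with budget r - 1, matching |S| + 1 ≤ r; below budget
1 only the empty set is admissible. -/
lemma sum_subsetsT {n : ℕ} (L : List (Fin n)) : L.Nodup → ∀ (r : ℝ), 0 ≤ r →
    ∀ F : Finset (Fin n) → ℝ, ((subsetsT L r).val.map fun S => F S.toFinset).sum =
      ∑ S ∈ L.toFinset.powerset, if (S.card : ℝ) ≤ r then F S else 0 := by
  induction L with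
  | nil => intro _ r hr F; simp [subsetsT, hr]
  | cons a L ih =>
    intro hL r hr F
    have ha : a ∉ L.toFinset := by simpa using (List.nodup_cons.1 hL).1
    have hL' := (List.nodup_cons.1 hL).2
    by_cases h : 1 ≤ r
    · rw [subsetsT_cons a L h, List.map_append, List.sum_append, List.map_map,
        List.toFinset_cons, Finset.sum_powerset_insert ha, ← ih hL' r hr F, add_comm]
      congr 1
      have := ih hL' (r - 1) (by linarith) fun S => F (insert a S)
      simp only [Function.comp_def, List.toFinset_cons]
      rw [this]
      refine Finset.sum_congr rfl fun S hS => ?_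
      have haS : a ∉ S := fun h => ha (Finset.mem_powerset.1 hS h)
      rw [Finset.card_insert_of_notMem haS]
      push_cast
      simp only [le_sub_iff_add_le]
    · rw [subsetsT_cons_of_lt a L h, Finset.sum_eq_single ∅]
      · simp [hr]
      · intro S _ hS
        rw [if_neg]
        intro h'
        have : (1 : ℝ) ≤ S.card := by
          exact_mod_cast Finset.card_pos.2 (Finset.nonempty_iff_ne_empty.2 hS)
        linarith
      · intro h'; simp at h'

lemma influenceT_val {n : ℕ} (c : ℕ) (O : Oracle n) (δ : ℝ) (p : Branch n) (i : Fin n)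
    (Ss : List (List (Fin n))) : (influenceT c O δ p i Ss).val =
      (Ss.map fun S => if i ∈ S then (1 - δ) ^ S.length * O p S ^ 2 else 0).sum := by
  induction Ss with
  | nil => simp [influenceT]
  | cons S L ih =>
    by_cases h : i ∈ S
    · simp [influenceT, ih, h]
    · simp [influenceT, ih, h]

lemma one_lt_degBound {δ ε : ℝ} (h0 : 0 < δ) (h1 : δ < 1) (hε : 0 < ε) (hε' : ε < 1 / 2) :
    1 < degBound δ ε := by
  have h2 : 1 < Real.logb 2 (1 / ε) := by
    rw [Real.lt_logb_iff_rpow_lt (by norm_num) (by positivity), Real.rpow_one]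
    rw [lt_div_iff₀ hε]; linarith
  rw [degBound, lt_div_iff₀ h0]
  linarith

/-- The list of sets that the program enumerates. -/
def setList (n : ℕ) (d : ℝ) : List (List (Fin n)) := (subsetsT (List.finRange n) d).val

lemma influenceT_val_eq {n : ℕ} (c : ℕ) (f : Cube n → ℤˣ) (δ : ℝ) {d : ℝ} (hd : 0 ≤ d)
    (p : Branch n) (i : Fin n) :
    (influenceT c (oracleOf f) δ p i (setList n d)).val = noisyInf δ d (subfn f p) i := by
  have h := sum_subsetsT (List.finRange n) (List.nodup_finRange n) d hd
    fun S => if i ∈ S then (1 - δ) ^ S.card * fhat (subfn f p) S ^ 2 else 0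
  rw [influenceT_val, noisyInf, Finset.sum_filter]
  have e : ∀ S ∈ setList n d, (if i ∈ S then (1 - δ) ^ S.length * oracleOf f p S ^ 2 else 0) =
      if i ∈ S.toFinset then (1 - δ) ^ S.toFinset.card * fhat (subfn f p) S.toFinset ^ 2 else 0 := by
    intro S hS
    have hn : S.Nodup := (sublist_of_mem_subsetsT _ _ S hS).nodup (List.nodup_finRange n)
    rw [List.toFinset_card_of_nodup hn]
    simp only [List.mem_toFinset, oracleOf]
  rw [List.map_congr_left e, setList, h, List.toFinset_finRange, Finset.powerset_univ]
  refine Finset.sum_congr rfl fun S _ => ?_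
  by_cases h1 : i ∈ S <;> by_cases h2 : (S.card : ℝ) ≤ d <;> simp [h1, h2]

lemma argmaxT_spec {α β : Type} (g : α → Timed (β × ℝ)) (L : List α) : ∀ cur : β × ℝ,
    ((argmaxT g cur L).val = cur ∨ ∃ a ∈ L, (argmaxT g cur L).val = (g a).val) ∧
    cur.2 ≤ (argmaxT g cur L).val.2 ∧ ∀ a ∈ L, (g a).val.2 ≤ (argmaxT g cur L).val.2 := by
  induction L with
  | nil => intro cur; simp [argmaxT]
  | cons a L ih =>
    intro cur
    by_cases h : cur.2 < (g a).val.2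
    · obtain ⟨h1, h2, h3⟩ := ih (g a).val
      have e : (argmaxT g cur (a :: L)).val = (argmaxT g (g a).val L).val := by
        simp [argmaxT, h]
      rw [e]
      refine ⟨.inr ?_, h.le.trans h2, ?_⟩
      · rcases h1 with h1 | ⟨b, hb, h1⟩
        · exact ⟨a, by simp, h1⟩
        · exact ⟨b, by simp [hb], h1⟩
      · intro b hb
        rcases List.mem_cons.1 hb with rfl | hb
        · exact h2
        · exact h3 b hb
    · obtain ⟨h1, h2, h3⟩ := ih cur
      have e : (argmaxT g cur (a :: L)).val = (argmaxT g cur L).val := by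
        simp [argmaxT, h]
      rw [e]
      refine ⟨?_, h2, ?_⟩
      · rcases h1 with h1 | ⟨b, hb, h1⟩
        · exact .inl h1
        · exact .inr ⟨b, by simp [hb], h1⟩
      · intro b hb
        rcases List.mem_cons.1 hb with rfl | hb
        · exact (not_lt.1 h).trans h2
        · exact h3 b hb

/-- The dummy starting value lies strictly below all candidates, so it cannot survive a search
through a nonempty list. -/
lemma argmaxT_exists {α β : Type} (g : α → Timed (β × ℝ)) {L : List α} (hL : L ≠ [])
    {cur : β × ℝ} (h : ∀ a ∈ L, cur.2 < (g a).val.2) :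
    ∃ a ∈ L, (argmaxT g cur L).val = (g a).val ∧ ∀ b ∈ L, (g b).val.2 ≤ (g a).val.2 := by
  obtain ⟨h1, -, h3⟩ := argmaxT_spec g L cur
  rcases h1 with h1 | ⟨a, ha, h1⟩
  · obtain ⟨a, ha⟩ := List.exists_mem_of_ne_nil L hL
    have := h3 a ha
    rw [h1] at this
    exact absurd (h a ha) (not_lt.2 this)
  · exact ⟨a, ha, h1, h1 ▸ h3⟩

lemma scoreT_val {n : ℕ} [NeZero n] (c : ℕ) (f : Cube n → ℤˣ) {δ d : ℝ} (h1 : δ < 1) (hd : 0 ≤ d)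
    (p : Branch n) : ∃ i : Fin n, (∀ j, noisyInf δ d (subfn f p) j ≤ noisyInf δ d (subfn f p) i) ∧
      (scoreT c (oracleOf f) δ (setList n d) p).val = ((p, i), leafScore δ d f p) := by
  obtain ⟨i, -, hi, hmax⟩ := argmaxT_exists (fun i : Fin n => do
      let v ← influenceT c (oracleOf f) δ p i (setList n d)
      return (i, v)) (L := List.finRange n) (List.ne_nil_of_mem (List.mem_finRange 0))
    (cur := (0, -1)) (by
      intro i _
      simp only [Timed.val_bind, Timed.val_pure, influenceT_val_eq c f δ hd]
      linarith [noisyInf_nonneg h1 d (subfn f p) i])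
  simp only [Timed.val_bind, Timed.val_pure, influenceT_val_eq c f δ hd] at hi hmax
  have hmax' : ∀ j, noisyInf δ d (subfn f p) j ≤ noisyInf δ d (subfn f p) i :=
    fun j => hmax j (List.mem_finRange j)
  refine ⟨i, hmax', ?_⟩
  have := maxInf_eq hmax'
  rw [maxInf] at this
  rw [leafScore, this]
  simp only [scoreT, Timed.val_bind, Timed.val_pure, hi, powT_val]

@[simp] lemma leavesT_val {n : ℕ} (P : PTree n) : (leavesT P).val = P.leaves := by
  induction P with
  | leaf a => rfl
  | node i a b iha ihb => simp [leavesT, DecTree.leaves, iha, ihb]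

@[simp] lemma splitT_val {n : ℕ} (P : PTree n) (i : Fin n) : ∀ p : Branch n,
    (splitT P p i).val = P.split p i := by
  induction P with
  | leaf a => intro p; simp [splitT, DecTree.split]
  | node j a b iha ihb =>
    intro p
    rcases p with _ | ⟨⟨j', v⟩, p⟩
    · simp [splitT, DecTree.split]
    · by_cases hv : v = -1
      · simp [splitT, DecTree.split, hv, iha]
      · simp [splitT, DecTree.split, hv, ihb]

lemma leaves_ne_nil {n : ℕ} (P : PTree n) : P.leaves ≠ [] := by
  intro h
  have h1 := size_pos P
  have h2 := length_leaves P
  rw [h] at h2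
  simp at h2
  omega

/-- The tree after one iteration of the program. -/
def nextTree {n : ℕ} [NeZero n] (c : ℕ) (O : Oracle n) (δ : ℝ) (Ss : List (List (Fin n)))
    (P : PTree n) : PTree n :=
  P.split (argmaxT (scoreT c O δ Ss) (([], 0), -1) P.leaves).val.1.1
    (argmaxT (scoreT c O δ Ss) (([], 0), -1) P.leaves).val.1.2

lemma growT_val_succ {n : ℕ} [NeZero n] (c : ℕ) (O : Oracle n) (δ : ℝ) (Ss : List (List (Fin n)))
    (k : ℕ) (P : PTree n) :
    (growT c O δ Ss (k + 1) P).val = (growT c O δ Ss k (nextTree c O δ Ss P)).val := by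
  simp [growT, nextTree]

lemma growT_val_succ' {n : ℕ} [NeZero n] (c : ℕ) (O : Oracle n) (δ : ℝ) (Ss : List (List (Fin n)))
    (k : ℕ) : ∀ P : PTree n,
    (growT c O δ Ss (k + 1) P).val = nextTree c O δ Ss (growT c O δ Ss k P).val := by
  induction k with
  | zero => intro P; rw [growT_val_succ]; rfl
  | succ k ih => intro P; rw [growT_val_succ, ih, growT_val_succ]

lemma step_nextTree {n : ℕ} [NeZero n] (c : ℕ) (f : Cube n → ℤˣ) {δ d : ℝ} (h1 : δ < 1)
    (hd : 0 ≤ d) (P : PTree n) :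
    Step δ d f P (nextTree c (oracleOf f) δ (setList n d) P) := by
  obtain ⟨p, hp, he, hmax⟩ := argmaxT_exists (scoreT c (oracleOf f) δ (setList n d))
    (leaves_ne_nil P) (cur := (([], 0), -1)) (by
      intro p _
      obtain ⟨i, -, hi⟩ := scoreT_val c f h1 hd p
      rw [hi]
      have : 0 ≤ leafScore δ d f p := mul_nonneg (by positivity) (maxInf_nonneg h1 d _)
      simp only
      linarith)
  obtain ⟨i, hi, hv⟩ := scoreT_val c f h1 hd p
  refine ⟨p, hp, i, ?_, hi, ?_⟩
  · intro q hq
    obtain ⟨j, -, hj⟩ := scoreT_val c f h1 hd q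
    have := hmax q hq
    rwa [hj, hv] at this
  · rw [nextTree, he, hv]

/-- The tree of size `k + 1` built by the program. -/
def builtTree {n : ℕ} [NeZero n] (c : ℕ) (f : Cube n → ℤˣ) (δ d : ℝ) (k : ℕ) : PTree n :=
  (growT c (oracleOf f) δ (setList n d) k (.leaf ())).val

lemma step_builtTree {n : ℕ} [NeZero n] (c : ℕ) (f : Cube n → ℤˣ) {δ d : ℝ} (h1 : δ < 1)
    (hd : 0 ≤ d) (k : ℕ) : Step δ d f (builtTree c f δ d k) (builtTree c f δ d (k + 1)) := by
  rw [builtTree, builtTree, growT_val_succ']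
  exact step_nextTree c f h1 hd _

lemma reach_builtTree {n : ℕ} [NeZero n] (c : ℕ) (f : Cube n → ℤˣ) {δ d : ℝ} (h1 : δ < 1)
    (hd : 0 ≤ d) (k : ℕ) : Relation.ReflTransGen (Step δ d f) (.leaf ()) (builtTree c f δ d k) := by
  induction k with
  | zero => exact .refl
  | succ k ih => exact ih.tail (step_builtTree c f h1 hd k)

lemma size_builtTree {n : ℕ} [NeZero n] (c : ℕ) (f : Cube n → ℤˣ) {δ d : ℝ} (h1 : δ < 1)
    (hd : 0 ≤ d) (k : ℕ) : (builtTree c f δ d k).size = k + 1 := by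
  induction k with
  | zero => rfl
  | succ k ih => rw [(step_builtTree c f h1 hd k).size, ih]

lemma completeT_val {n : ℕ} (c : ℕ) (f : Cube n → ℤˣ) (P : PTree n) : ∀ p : Branch n,
    (completeT c (oracleOf f) p P).val = completion (subfn f p) P := by
  induction P with
  | leaf a =>
    intro p
    have : fhat (subfn f p) ∅ = avg (subfn f p) := by simp [fhat, avg]
    simp [completeT, completion, oracleOf, this]
  | node i a b iha ihb =>
    intro p
    simp [completeT, completion, iha, ihb, subfn_concat]

lemma buildT_val {n : ℕ} [NeZero n] (c : ℕ) (f : Cube n → ℤˣ) (t : ℕ) (δ ε : ℝ) :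
    (buildT c (oracleOf f) t δ ε).val =
      completion f (builtTree c f δ (degBound δ ε) (t - 1)) := by
  simp only [buildT, Timed.val_bind, completeT_val]
  rfl

lemma isOutput_buildT {n : ℕ} [NeZero n] (c : ℕ) (f : Cube n → ℤˣ) {t : ℕ} (ht : 1 ≤ t) {δ ε : ℝ}
    (h0 : 0 < δ) (h1 : δ < 1) (hε : 0 < ε) (hε' : ε < 1 / 2) :
    IsOutput f t δ ε (buildT c (oracleOf f) t δ ε).val := by
  have hd : 0 ≤ degBound δ ε := by linarith [one_lt_degBound h0 h1 hε hε']
  refine ⟨_, reach_builtTree c f h1 hd (t - 1), ?_, buildT_val c f t δ ε⟩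
  rw [size_builtTree c f h1 hd]
  omega

/-! ### The number of steps -/

/-- The output is never empty, so the constant overhead of a call can be charged to an output
element. -/
lemma subsetsT_cost_le {n : ℕ} (L : List (Fin n)) : ∀ r : ℝ,
    (subsetsT L r).cost ≤ (2 * L.length + 1) * (subsetsT L r).val.length := by
  induction L with
  | nil => intro r; simp [subsetsT]
  | cons a L ih =>
    intro r
    by_cases h : 1 ≤ r
    · have h1 := ih (r - 1)
      have h2 := ih r
      rw [subsetsT_cons a L h]
      simp only [List.length_append, List.length_map, List.length_cons]
      have hpos : 1 ≤ (subsetsT L r).val.length := by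
        rw [Nat.one_le_iff_ne_zero, Ne, List.length_eq_zero_iff]
        rcases L with _ | ⟨b, L⟩
        · simp [subsetsT]
        · intro h'
          rw [subsetsT_cons b L h, List.append_eq_nil_iff] at h'
          have h3 := ih r
          have h4 : 1 ≤ (subsetsT (b :: L) r).cost := by simp [subsetsT, h]
          rw [subsetsT_cons b L h, h'.1, h'.2] at h3
          simp at h3
          omega
      simp only [subsetsT, h, if_true, Timed.cost_bind, tick_cost, Timed.cost_pure]
      nlinarith
    · rw [subsetsT_cons_of_lt a L h]
      simp [subsetsT, h]

lemma length_subsetsT_le_two_pow {n : ℕ} (L : List (Fin n)) : ∀ r : ℝ,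
    (subsetsT L r).val.length ≤ 2 ^ L.length := by
  induction L with
  | nil => intro r; simp [subsetsT]
  | cons a L ih =>
    intro r
    by_cases h : 1 ≤ r
    · rw [subsetsT_cons a L h]
      simp only [List.length_append, List.length_map, List.length_cons, pow_succ]
      linarith [ih r, ih (r - 1)]
    · rw [subsetsT_cons_of_lt a L h]
      simpa using Nat.one_le_two_pow

/-- With l = |L|, the recursion closes because (l+1)^{r-1} + (l+1)^r = (l+1)^{r-1}(l+2) ≤ (l+2)^r.
-/
lemma length_subsetsT_le_rpow {n : ℕ} (L : List (Fin n)) : ∀ r : ℝ, 0 ≤ r →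
    ((subsetsT L r).val.length : ℝ) ≤ (L.length + 1 : ℝ) ^ r := by
  induction L with
  | nil => intro r _; simp [subsetsT]
  | cons a L ih =>
    intro r hr
    by_cases h : 1 ≤ r
    · rw [subsetsT_cons a L h]
      simp only [List.length_append, List.length_map, List.length_cons]
      push_cast
      have h1 := ih (r - 1) (by linarith)
      have h2 := ih r hr
      have hl : (0 : ℝ) < L.length + 1 := by positivity
      calc ((subsetsT L (r - 1)).val.length : ℝ) + (subsetsT L r).val.length
          ≤ (L.length + 1 : ℝ) ^ (r - 1) + (L.length + 1 : ℝ) ^ r := add_le_add h1 h2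
        _ = (L.length + 1 : ℝ) ^ (r - 1) * (L.length + 1 + 1) := by
          rw [Real.rpow_sub_one hl.ne']; field_simp; ring
        _ ≤ (L.length + 1 + 1 : ℝ) ^ (r - 1) * (L.length + 1 + 1) := by
          gcongr
          · linarith
        _ = (L.length + 1 + 1 : ℝ) ^ r := by
          rw [Real.rpow_sub_one (by positivity)]; field_simp
    · rw [subsetsT_cons_of_lt a L h]
      simp only [List.length_singleton, Nat.cast_one]
      exact Real.one_le_rpow (by linarith [(Nat.cast_nonneg L.length : (0:ℝ) ≤ _)]) hr

lemma length_setList_le {n : ℕ} [NeZero n] {d : ℝ} (hd : 0 ≤ d) :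
    ((setList n d).length : ℝ) ≤ 2 * ((n : ℝ) ^ d) ^ 2 := by
  -- For n ≥ 2, n + 1 ≤ n² turns (n+1)^d into (n^d)². For n = 1 the power is 1, and the factor 2
  -- counts the two subsets.
  rcases (NeZero.one_le : 1 ≤ n).eq_or_lt with rfl | hn
  · have := length_subsetsT_le_two_pow (List.finRange 1) d
    simp only [List.length_finRange, pow_one] at this
    simpa [setList] using this
  · have h := length_subsetsT_le_rpow (List.finRange n) d hd
    rw [List.length_finRange] at h
    have hn' : (2 : ℝ) ≤ n := by exact_mod_cast hn
    have h2 : ((n : ℝ) + 1) ^ d ≤ ((n : ℝ) ^ d) ^ 2 := by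
      rw [pow_two, ← Real.mul_rpow (by positivity) (by positivity)]
      exact Real.rpow_le_rpow (by positivity) (by nlinarith) hd
    have h3 : (0 : ℝ) ≤ ((n : ℝ) ^ d) ^ 2 := by positivity
    rw [setList]
    linarith

lemma influenceT_cost_le {n : ℕ} (c : ℕ) (O : Oracle n) (δ : ℝ) (p : Branch n) (i : Fin n) {m : ℕ}
    (Ss : List (List (Fin n))) (h : ∀ S ∈ Ss, S.length ≤ m) :
    (influenceT c O δ p i Ss).cost ≤
      Ss.length * (3 * m + 2 ^ (c * p.length) + p.length + 5) + 1 := by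
  induction Ss with
  | nil => simp [influenceT]
  | cons S L ih =>
    have h1 := ih fun S hS => h S (by simp [hS])
    have h2 := h S (by simp)
    have h3 : 0 < 2 ^ (c * p.length) := by positivity
    simp only [List.length_cons, add_mul, one_mul] at h1 ⊢
    by_cases hi : i ∈ S
    · simp only [influenceT, hi, if_true, Timed.cost_bind, tick_cost, Timed.cost_pure, query_cost,
        powT_cost]
      omega
    · simp only [influenceT, hi, if_false, Timed.cost_bind, tick_cost, Timed.cost_pure]
      omega

lemma argmaxT_cost_le {α β : Type} (g : α → Timed (β × ℝ)) {K : ℕ} (L : List α)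
    (h : ∀ a ∈ L, (g a).cost ≤ K) : ∀ cur : β × ℝ,
    (argmaxT g cur L).cost ≤ L.length * (K + 1) + 1 := by
  induction L with
  | nil => intro cur; simp [argmaxT]
  | cons a L ih =>
    intro cur
    have h1 := ih fun b hb => h b (by simp [hb])
    have h2 := h a (by simp)
    simp only [List.length_cons, add_mul, one_mul] at h1 ⊢
    by_cases hc : cur.2 < (g a).val.2
    · have := h1 (g a).val
      simp only [argmaxT, hc, if_true, Timed.cost_bind, tick_cost]
      omega
    · have := h1 cur
      simp only [argmaxT, hc, if_false, Timed.cost_bind, tick_cost]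
      omega

lemma scoreT_cost_le {n : ℕ} [NeZero n] (c : ℕ) (O : Oracle n) (δ : ℝ) {Ss : List (List (Fin n))}
    {Y : ℕ} (hY : 1 ≤ Y) (hn : n ≤ Y) (hSs : Ss.length ≤ Y) (hS : ∀ S ∈ Ss, S.length ≤ n)
    {p : Branch n} (hp : p.length ≤ Y) (hp' : 2 ^ (c * p.length) ≤ Y) :
    (scoreT c O δ Ss p).cost ≤ 17 * Y ^ 3 := by
  have h1 : ∀ i ∈ List.finRange n, ((do
      let v ← influenceT c O δ p i Ss
      return (i, v)) : Timed (Fin n × ℝ)).cost ≤ 11 * Y ^ 2 := by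
    intro i _
    simp only [Timed.cost_bind, Timed.cost_pure, add_zero]
    calc _ ≤ _ := influenceT_cost_le c O δ p i Ss hS
      _ ≤ Y * (3 * Y + Y + Y + 5) + 1 := by gcongr
      _ ≤ 11 * Y ^ 2 := by nlinarith
  have h2 := argmaxT_cost_le _ _ h1 (0, -1)
  rw [List.length_finRange] at h2
  have h3 : n * (11 * Y ^ 2 + 1) + 1 ≤ Y * (11 * Y ^ 2 + 1) + 1 := by gcongr
  have h4 : Y ≤ Y ^ 3 := Nat.le_self_pow (by norm_num) Y
  have h5 : Y * (11 * Y ^ 2 + 1) = 11 * Y ^ 3 + Y := by ring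
  simp only [scoreT, Timed.cost_bind, tick_cost, Timed.cost_pure, powT_cost]
  omega

lemma leavesT_cost_le {n : ℕ} (P : PTree n) : (leavesT P).cost ≤ 2 * P.size ^ 2 := by
  induction P with
  | leaf a => simp [leavesT, DecTree.size]
  | node i a b iha ihb =>
    have h1 := size_pos a
    have h2 := size_pos b
    simp only [leavesT, DecTree.size, Timed.cost_bind, tick_cost, Timed.cost_pure, leavesT_val,
      length_leaves]
    nlinarith

lemma splitT_cost_le {n : ℕ} (P : PTree n) (i : Fin n) : ∀ p : Branch n,
    (splitT P p i).cost ≤ P.size := by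
  induction P with
  | leaf a => intro p; simp [splitT, DecTree.size]
  | node j a b iha ihb =>
    intro p
    have h1 := size_pos a
    have h2 := size_pos b
    rcases p with _ | ⟨⟨j', v⟩, p⟩
    · simp only [splitT, DecTree.size, Timed.cost_bind, tick_cost, Timed.cost_pure]
      omega
    · have h3 := iha p
      have h4 := ihb p
      by_cases hv : v = -1
      · simp only [splitT, DecTree.size, hv, if_true, Timed.cost_bind, tick_cost, Timed.cost_pure]
        omega
      · simp only [splitT, DecTree.size, hv, if_false, Timed.cost_bind, tick_cost, Timed.cost_pure]
        omega

/-- The size of a tree and the cost of queries at its leaves are at most `Y`. -/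
def Bounded {n : ℕ} (c Y : ℕ) (P : PTree n) : Prop :=
  P.size ≤ Y ∧ ∀ p ∈ P.leaves, 2 ^ (c * p.length) ≤ Y

lemma growT_cost_le {n : ℕ} [NeZero n] (c : ℕ) (O : Oracle n) (δ : ℝ) {Ss : List (List (Fin n))}
    {Y : ℕ} (hY : 1 ≤ Y) (hn : n ≤ Y) (hSs : Ss.length ≤ Y) (hS : ∀ S ∈ Ss, S.length ≤ n)
    (k : ℕ) : ∀ P : PTree n, (∀ j ≤ k, Bounded c Y (growT c O δ Ss j P).val) →
      (growT c O δ Ss k P).cost ≤ k * (23 * Y ^ 4) + 1 := by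
  induction k with
  | zero => intro P _; simp [growT]
  | succ k ih =>
    intro P hP
    have h0 : Bounded c Y P := hP 0 (by omega)
    have h1 := ih (nextTree c O δ Ss P) (by
      intro j hj
      rw [← growT_val_succ]
      exact hP (j + 1) (by omega))
    have h2 := argmaxT_cost_le (scoreT c O δ Ss) P.leaves (fun p hp =>
      scoreT_cost_le c O δ hY hn hSs hS ((length_lt_size P p hp).le.trans h0.1) (h0.2 p hp))
      (([], 0), -1)
    rw [length_leaves] at h2
    have h3 := leavesT_cost_le P
    have h4 : 2 * P.size ^ 2 ≤ 2 * Y ^ 2 := by gcongr; exact h0.1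
    have h5 : P.size * (17 * Y ^ 3 + 1) + 1 ≤ Y * (17 * Y ^ 3 + 1) + 1 := by gcongr; exact h0.1
    have h6 := (splitT_cost_le P (argmaxT (scoreT c O δ Ss) (([], 0), -1) P.leaves).val.1.2
      (argmaxT (scoreT c O δ Ss) (([], 0), -1) P.leaves).val.1.1).trans h0.1
    have h7 : Y ≤ Y ^ 4 := Nat.le_self_pow (by norm_num) Y
    have h8 : Y ^ 2 ≤ Y ^ 4 := Nat.pow_le_pow_right hY (by norm_num)
    have h9 : Y * (17 * Y ^ 3 + 1) = 17 * Y ^ 4 + Y := by ring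
    have h10 : (k + 1) * (23 * Y ^ 4) = k * (23 * Y ^ 4) + 23 * Y ^ 4 := by ring
    rw [nextTree] at h1
    simp only [growT, Timed.cost_bind, tick_cost, leavesT_val, splitT_val]
    omega

/-- The summand 2t + 1 on the left is an amortization: each leaf prepays one internal node, and
there is one internal node fewer than leaves. -/
lemma completeT_cost_le {n : ℕ} (c : ℕ) (O : Oracle n) {Y t : ℕ} (P : PTree n) :
    ∀ p : Branch n, (∀ q ∈ P.leaves, 2 ^ (c * (p ++ q).length) ≤ Y ∧ (p ++ q).length ≤ t) →
    (completeT c O p P).cost + (2 * t + 1) ≤ P.size * (Y + 3 * t + 2) := by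
  induction P with
  | leaf a =>
    intro p h
    have := h [] (by simp [DecTree.leaves])
    simp only [List.append_nil] at this
    simp only [completeT, DecTree.size, Timed.cost_bind, tick_cost, Timed.cost_pure, query_cost,
      List.length_nil]
    omega
  | node i a b iha ihb =>
    intro p h
    have h1 := iha (p ++ [(i, -1)]) fun q hq => by
      rw [List.append_assoc]
      exact h _ (by simp [DecTree.leaves, hq])
    have h2 := ihb (p ++ [(i, 1)]) fun q hq => by
      rw [List.append_assoc]
      exact h _ (by simp [DecTree.leaves, hq])
    obtain ⟨q, hq⟩ := List.exists_mem_of_ne_nil _ (leaves_ne_nil (.node i a b))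
    have h3 := (h q hq).2
    rw [List.length_append] at h3
    simp only [completeT, DecTree.size, Timed.cost_bind, tick_cost, Timed.cost_pure, add_mul]
      at h1 h2 ⊢
    omega

lemma buildT_cost_le {n : ℕ} [NeZero n] (c : ℕ) (f : Cube n → ℤˣ) {t Y : ℕ} (δ ε : ℝ)
    (hY : 1 ≤ Y) (hn : n ≤ Y) (ht : t ≤ Y) (hSs : (setList n (degBound δ ε)).length ≤ Y)
    (hB : ∀ j ≤ t - 1, Bounded c Y (builtTree c f δ (degBound δ ε) j)) :
    (buildT c (oracleOf f) t δ ε).cost ≤ 40 * Y ^ 5 := by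
  have hS : ∀ S ∈ setList n (degBound δ ε), S.length ≤ n := fun S hS => by
    simpa using (sublist_of_mem_subsetsT _ _ S hS).length_le
  have h1 := subsetsT_cost_le (List.finRange n) (degBound δ ε)
  rw [List.length_finRange] at h1
  have h2 := growT_cost_le c (oracleOf f) δ hY hn hSs hS (t - 1) (.leaf ()) hB
  have hBt := hB (t - 1) le_rfl
  have h3 := completeT_cost_le c (oracleOf f) (Y := Y) (t := Y) (builtTree c f δ (degBound δ ε) (t - 1)) [] (by
    intro q hq
    exact ⟨hBt.2 q hq, (length_lt_size _ q hq).le.trans hBt.1⟩)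
  have h4 : (2 * n + 1) * (subsetsT (List.finRange n) (degBound δ ε)).val.length ≤
      (2 * Y + 1) * Y := by gcongr; exact hSs
  have h5 : (t - 1) * (23 * Y ^ 4) ≤ Y * (23 * Y ^ 4) := by gcongr; omega
  have h6 : (builtTree c f δ (degBound δ ε) (t - 1)).size * (Y + 3 * Y + 2) ≤
      Y * (Y + 3 * Y + 2) := by gcongr; exact hBt.1
  have h7 : Y ≤ Y ^ 5 := Nat.le_self_pow (by norm_num) Y
  have h8 : Y ^ 2 ≤ Y ^ 5 := Nat.pow_le_pow_right hY (by norm_num)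
  have e1 : (2 * Y + 1) * Y = 2 * Y ^ 2 + Y := by ring
  have e2 : Y * (23 * Y ^ 4) = 23 * Y ^ 5 := by ring
  have e3 : Y * (Y + 3 * Y + 2) = 4 * Y ^ 2 + 2 * Y := by ring
  have e4 : (buildT c (oracleOf f) t δ ε).cost =
      n + 3 + ((subsetsT (List.finRange n) (degBound δ ε)).cost +
        ((growT c (oracleOf f) δ (setList n (degBound δ ε)) (t - 1) (.leaf ())).cost +
          (completeT c (oracleOf f) [] (builtTree c f δ (degBound δ ε) (t - 1))).cost)) := rfl
  rw [e4]
  omega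

/-! ### The time bound -/

lemma one_le_rpow_degBound {n : ℕ} [NeZero n] {d : ℝ} (hd : 0 ≤ d) : 1 ≤ (n : ℝ) ^ d :=
  Real.one_le_rpow (by exact_mod_cast (NeZero.one_le : 1 ≤ n)) hd

lemma cast_le_rpow_degBound {n : ℕ} [NeZero n] {d : ℝ} (hd : 1 ≤ d) : (n : ℝ) ≤ (n : ℝ) ^ d :=
  Real.self_le_rpow_of_one_le (by exact_mod_cast (NeZero.one_le : 1 ≤ n)) hd

lemma logb_effSize_le (n s : ℕ) [NeZero n] : Real.logb 2 (effSize n s) ≤ n := by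
  have h : (effSize n s : ℝ) ≤ (2 : ℝ) ^ n := by
    exact_mod_cast (min_le_right (max s 2) (2 ^ n) : effSize n s ≤ 2 ^ n)
  have h0 : (0 : ℝ) < effSize n s := by
    have := two_le_effSize n s
    exact_mod_cast (by omega : 0 < effSize n s)
  have h2 := Real.logb_le_logb_of_le (b := 2) (by norm_num) h0 h
  rwa [Real.logb_pow, Real.logb_self_eq_one (by norm_num), mul_one] at h2

lemma logb_two_le_self {x : ℝ} (hx : 1 ≤ x) : Real.logb 2 x ≤ x := by
  rw [Real.logb_le_iff_le_rpow (by norm_num) (by linarith)]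
  have h := one_add_mul_self_le_rpow_one_add (s := 1) (by norm_num) hx
  norm_num at h
  linarith

lemma one_div_le_rpow_degBound {n : ℕ} (hn : 2 ≤ n) {δ ε : ℝ} (h0 : 0 < δ) (h1 : δ < 1)
    (hε : 0 < ε) (hε' : ε < 1 / 2) : 1 / ε ≤ (n : ℝ) ^ degBound δ ε := by
  have hn' : (2 : ℝ) ≤ n := by exact_mod_cast hn
  have hpos : (0 : ℝ) < 1 / ε := by positivity
  have hlog : 0 ≤ Real.logb 2 (1 / ε) :=
    Real.logb_nonneg (by norm_num) (by rw [le_div_iff₀ hε]; linarith)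
  calc 1 / ε = (2 : ℝ) ^ Real.logb 2 (1 / ε) :=
        (Real.rpow_logb (by norm_num) (by norm_num) hpos).symm
    _ ≤ (2 : ℝ) ^ degBound δ ε := by
        apply Real.rpow_le_rpow_of_exponent_le (by norm_num)
        rw [degBound, le_div_iff₀ h0]
        nlinarith
    _ ≤ (n : ℝ) ^ degBound δ ε :=
        Real.rpow_le_rpow (by norm_num) hn' (by linarith [one_lt_degBound h0 h1 hε hε'])

/-- By `Good.depth`, 2^{|p|} is at most 2m divided by `scoreBound`; both logarithms and 1/ε are at
most a constant times n^d. -/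
lemma Good.two_pow_length_le {n : ℕ} [NeZero n] {f : Cube n → ℤˣ} {δ κ ε : ℝ} {s : ℕ} {P : PTree n}
    (h0 : 0 < δ) (h1 : δ < 1) (hε : 0 < ε) (hε' : ε < 1 / 2)
    (hP : Good f δ κ (scoreBound n s ε) P) {t : ℕ} (ht : P.size ≤ t) {p : Branch n}
    (hp : p ∈ P.leaves) : (2 : ℝ) ^ p.length ≤ 160 * (t * (n : ℝ) ^ degBound δ ε) ^ 4 := by
  have hd := one_lt_degBound h0 h1 hε hε'
  have hZ := one_le_rpow_degBound (n := n) (d := degBound δ ε) (by linarith)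
  have hnZ := cast_le_rpow_degBound (n := n) hd.le
  have hZ' := fun hn => one_div_le_rpow_degBound (n := n) hn h0 h1 hε hε'
  set Z := (n : ℝ) ^ degBound δ ε
  have ht1 : (1 : ℝ) ≤ t := by exact_mod_cast (size_pos P).trans ht
  have hX : 1 ≤ t * Z := one_le_mul_of_one_le_of_one_le ht1 hZ
  have hX4 : 1 ≤ (t * Z) ^ 4 := one_le_pow₀ hX
  -- For n = 1 the power n^d does not control 1/ε, but a read-once branch has length at most 1.
  rcases (NeZero.one_le : 1 ≤ n).eq_or_lt with hn | hn
  · have hl : p.length ≤ 1 := by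
      have := (hP.readOnce p hp).length_le_card
      simpa [← hn] using this
    have : (2 : ℝ) ^ p.length ≤ 2 ^ 1 := pow_le_pow_right₀ (by norm_num) hl
    linarith
  by_cases hne : p = []
  · rw [hne]; simp; linarith
  have hdep := hP.depth p hp hne
  have e1 := one_le_logb (two_le_effSize n s)
  have e2 := two_le_logb_div (two_le_effSize n s) hε hε'
  have hs0 : (0 : ℝ) < effSize n s := by
    have := two_le_effSize n s
    exact_mod_cast (by omega : 0 < effSize n s)
  have m1 := (logb_effSize_le n s).trans hnZ
  have hεZ := hZ' hn
  have m2 : Real.logb 2 (effSize n s / ε) ≤ 2 * Z := by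
    rw [div_eq_mul_one_div, Real.logb_mul hs0.ne' (by positivity)]
    have := logb_two_le_self (x := 1 / ε) (by rw [le_div_iff₀ hε]; linarith)
    linarith
  rw [scoreBound] at hdep
  have key : (2 : ℝ) ^ p.length ≤ 2 * P.size *
      (40 * Real.logb 2 (effSize n s) * Real.logb 2 (effSize n s / ε)) * (1 / ε) := by
    have hc : 0 < 40 * Real.logb 2 (effSize n s) * Real.logb 2 (effSize n s / ε) := by positivity
    rw [← mul_div_assoc, div_le_iff₀ hc] at hdep
    rw [mul_one_div, le_div_iff₀ hε]
    exact hdep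
  have hsz : (P.size : ℝ) ≤ t := by exact_mod_cast ht
  calc (2 : ℝ) ^ p.length ≤ _ := key
    _ ≤ 2 * t * (40 * Z * (2 * Z)) * Z := by gcongr
    _ = 160 * (t * Z ^ 3) := by ring
    _ ≤ 160 * (t ^ 4 * Z ^ 4) := by
        gcongr
        · exact le_self_pow₀ ht1 (by norm_num)
        · norm_num
    _ = _ := by ring

/-- The constant and the exponent of the time bound. -/
def timeConst (c : ℕ) : ℕ := 40 * (4 + 160 ^ c) ^ 5 + (4 * c + 2) * 5

lemma buildT_cost_le_timeConst {n : ℕ} [NeZero n] (c : ℕ) (f : Cube n → ℤˣ) {t : ℕ} (ht : 1 ≤ t)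
    {δ ε : ℝ} (h0 : 0 < δ) (h1 : δ < 1) (hε : 0 < ε) (hε' : ε < 1 / 2)
    (h : ∀ j ≤ t - 1, ∀ p ∈ (builtTree c f δ (degBound δ ε) j).leaves,
      ((2 : ℝ) ^ p.length) ^ c ≤ (160 * (t * (n : ℝ) ^ degBound δ ε) ^ 4) ^ c) :
    ((buildT c (oracleOf f) t δ ε).cost : ℝ) ≤
      timeConst c * (t * (n : ℝ) ^ degBound δ ε) ^ timeConst c := by
  have hd := one_lt_degBound h0 h1 hε hε'
  have hZ := one_le_rpow_degBound (n := n) (d := degBound δ ε) (by linarith)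
  have hnZ := cast_le_rpow_degBound (n := n) hd.le
  have hN := length_setList_le (n := n) (d := degBound δ ε) (by linarith)
  set Z := (n : ℝ) ^ degBound δ ε
  have ht1 : (1 : ℝ) ≤ t := by exact_mod_cast ht
  set X := (t : ℝ) * Z with hXdef
  have hX : 1 ≤ X := one_le_mul_of_one_le_of_one_le ht1 hZ
  have hZX : Z ≤ X := le_mul_of_one_le_left (by linarith) ht1
  have htX : (t : ℝ) ≤ X := le_mul_of_one_le_right (by linarith) hZ
  -- W bounds the charge 2^{c|p|} by a natural number, so that the sum Y dominates every parameter
  -- of the step count.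
  set W := ⌊(160 * X ^ 4) ^ c⌋₊ with hW
  set Y := n + t + (setList n (degBound δ ε)).length + W with hY
  have hcost : (buildT c (oracleOf f) t δ ε).cost ≤ 40 * Y ^ 5 := by
    refine buildT_cost_le c f δ ε (by omega) (by omega) (by omega) (by omega) fun j hj => ⟨?_, ?_⟩
    · rw [size_builtTree c f h1 (by linarith)]; omega
    · intro p hp
      have h2 : 2 ^ (c * p.length) ≤ W := by
        rw [hW]
        apply Nat.le_floor
        have := h j hj p hp
        rw [← pow_mul, mul_comm] at this
        exact_mod_cast this
      omega
  have hWX : (W : ℝ) ≤ 160 ^ c * X ^ (4 * c) := by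
    have : (W : ℝ) ≤ (160 * X ^ 4) ^ c := Nat.floor_le (by positivity)
    rwa [mul_pow, ← pow_mul] at this
  have p1 : X ≤ X ^ (4 * c + 2) := le_self_pow₀ hX (by omega)
  have p2 : X ^ 2 ≤ X ^ (4 * c + 2) := pow_le_pow_right₀ hX (by omega)
  have p3 : X ^ (4 * c) ≤ X ^ (4 * c + 2) := pow_le_pow_right₀ hX (by omega)
  have hYX : (Y : ℝ) ≤ (4 + 160 ^ c) * X ^ (4 * c + 2) := by
    have hN' : ((setList n (degBound δ ε)).length : ℝ) ≤ 2 * X ^ 2 :=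
      hN.trans (by gcongr)
    have hW' : (W : ℝ) ≤ 160 ^ c * X ^ (4 * c + 2) := hWX.trans (by gcongr)
    rw [hY]
    push_cast
    linarith
  calc ((buildT c (oracleOf f) t δ ε).cost : ℝ) ≤ 40 * (Y : ℝ) ^ 5 := by exact_mod_cast hcost
    _ ≤ 40 * ((4 + 160 ^ c) * X ^ (4 * c + 2)) ^ 5 := by gcongr
    _ = (40 * (4 + 160 ^ c) ^ 5 : ℕ) * X ^ ((4 * c + 2) * 5) := by
        rw [mul_pow, ← pow_mul]; push_cast; ring
    _ ≤ timeConst c * X ^ timeConst c := by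
        have a1 : 40 * (4 + 160 ^ c) ^ 5 ≤ timeConst c := Nat.le_add_right _ _
        have a2 : (4 * c + 2) * 5 ≤ timeConst c := Nat.le_add_left _ _
        have a1' : ((40 * (4 + 160 ^ c) ^ 5 : ℕ) : ℝ) ≤ timeConst c := by exact_mod_cast a1
        have a3 : X ^ ((4 * c + 2) * 5) ≤ X ^ timeConst c := pow_le_pow_right₀ hX a2
        gcongr

end StabDT

end

open StabDT
theorem mainTheorem2 :
    ∃ A C : ℝ, 0 < A ∧ 0 < C ∧ ∃ B : ℕ → ℕ,
      ∀ (n : ℕ) [NeZero n] (f : Cube n → ℤˣ) (δ κ : ℝ),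
        0 < δ → δ < 1 → 0 < κ → κ < 1 → noiseSens δ f ≤ κ →
      ∀ (s : ℕ) (ε : ℝ), 1 ≤ s → 0 < ε → ε < 1 / 2 →
      ∀ t : ℕ, (s : ℝ) ^ (A * (κ * Real.logb 2 (s / ε) / (ε * δ))) ≤ t →
        -- every possible output, however ties are broken, has size `t` and small error
        (∀ T : DTree n, IsOutput f t δ ε T →
          T.size = t ∧ StabDT.err f T ≤ C * (opt f s + κ) + ε) ∧
        -- the program returns such an output in time `poly(t, n ^ (log (1/ε) / δ))`
        (IsOutput f t δ ε (buildT 0 (oracleOf f) t δ ε).val ∧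
          ((buildT 0 (oracleOf f) t δ ε).cost : ℝ) ≤
            B 0 * ((t : ℝ) * (n : ℝ) ^ (Real.logb 2 (1 / ε) / δ)) ^ B 0) ∧
        -- even if queries about a leaf at depth `k` cost `2 ^ (c * k)`, the error bound is
        -- reached within the polynomial time bound, at some size `t' ≤ t`
        (∀ c : ℕ, ∃ t' : ℕ, 1 ≤ t' ∧ t' ≤ t ∧
          IsOutput f t' δ ε (buildT c (oracleOf f) t' δ ε).val ∧
          StabDT.err f (buildT c (oracleOf f) t' δ ε).val ≤ C * (opt f s + κ) + ε ∧
          ((buildT c (oracleOf f) t' δ ε).cost : ℝ) ≤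
            B c * ((t' : ℝ) * (n : ℝ) ^ (Real.logb 2 (1 / ε) / δ)) ^ B c) := by
  refine ⟨128, 24, by norm_num, by norm_num, timeConst, ?_⟩
  intro n _ f δ κ h0 h1 hκ _ hf s ε hs hε hε' t ht
  have hd : 0 ≤ degBound δ ε := by linarith [one_lt_degBound h0 h1 hε hε']
  have hs1 : (1 : ℝ) ≤ s := by exact_mod_cast hs
  have hlog : 0 ≤ Real.logb 2 (s / ε) :=
    Real.logb_nonneg (by norm_num) (by rw [le_div_iff₀ hε]; linarith)
  have ht1 : 1 ≤ t := by
    have h : (1 : ℝ) ≤ t := (Real.one_le_rpow hs1 (by positivity)).trans ht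
    exact_mod_cast h
  refine ⟨?_, ⟨isOutput_buildT 0 f ht1 h0 h1 hε hε', ?_⟩, ?_⟩
  · rintro T ⟨P, hP, hsize, rfl⟩
    refine ⟨(size_completion P f).trans hsize, ?_⟩
    exact err_le_of_reach h0 h1 hε hε' hκ hf hs hP (hsize ▸ ht)
  -- With c = 0 both sides of the depth condition are 1, so no depth bound is needed at the full
  -- size t.
  · exact buildT_cost_le_timeConst 0 f ht1 h0 h1 hε hε' fun j _ p _ => by simp
  · intro c
    -- The size t' is one more than the least number of iterations after which the goal is met. The
    -- depth bound is available up to that point.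
    have hex : ∃ k, StabDT.err f (completion f (builtTree c f δ (degBound δ ε) k)) ≤
        goalErr f s κ ε := by
      refine ⟨t - 1, err_le_of_reach h0 h1 hε hε' hκ hf hs (reach_builtTree c f h1 hd _) ?_⟩
      rw [size_builtTree c f h1 hd, Nat.sub_add_cancel ht1]
      exact ht
    classical
    have hle : Nat.find hex ≤ t - 1 := by
      apply Nat.find_le
      refine err_le_of_reach h0 h1 hε hε' hκ hf hs (reach_builtTree c f h1 hd _) ?_
      rw [size_builtTree c f h1 hd, Nat.sub_add_cancel ht1]
      exact ht
    have hgood : ∀ j ≤ Nat.find hex,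
        Good f δ κ (scoreBound n s ε) (builtTree c f δ (degBound δ ε) j) := by
      intro j
      induction j with
      | zero => exact fun _ => good_leaf hf _
      | succ j ih =>
        intro hj
        -- Only the predecessor must have too large an error, so the final tree, which meets the
        -- goal, still satisfies `Good`.
        have hg := ih (by omega)
        exact hg.step h0 h1 (scoreBound_pos n s hε hε') (step_builtTree c f h1 hd j)
          (hg.readOnce.scoreBound_le h0 h1 hε hε' hκ hf hs
            (not_le.1 (Nat.find_min hex (by omega))))
    refine ⟨Nat.find hex + 1, by omega, by omega,
      isOutput_buildT c f (by omega) h0 h1 hε hε', ?_, ?_⟩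
    · rw [buildT_val]
      exact Nat.find_spec hex
    · refine buildT_cost_le_timeConst c f (by omega) h0 h1 hε hε' fun j hj p hp => ?_
      refine pow_le_pow_left₀ (by positivity) ?_ c
      refine (hgood j (by omega)).two_pow_length_le h0 h1 hε hε' ?_ hp
      rw [size_builtTree c f h1 hd]
      omega
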